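/- Setting. Let $\mathcal H$ be a real separable Hilbert space and let $(x,\varepsilon)$ be a random pair in $\mathcal H\times\mathbb R$ such that: (i) $\mathbb E[x]=0$ and $\mathbb E\|x\|^2<\infty$; the covariance operator $\Sigma u:=\mathbb E[\langle u,x\rangle x]$ has an orthonormal basis of eigenvectors $v_1,v_2,\dots$ of $\mathcal H$ (finite if $\dim\mathcal H<\infty$) with eigenvalues $\lambda_1\ge\lambda_2\ge\dots$ (put $\lambda_j=0$ for $j>\dim\mathcal H$); (ii) for some $\sigma_x>0$, $\mathbb E[e^{\langle v,x\rangle}]\le e^{\frac{\sigma_x^2}{2}\langle\Sigma v,v\rangle}$ for all $v\in\mathcal H$, and the components $\langle v_j,x\rangle$, $j\ge1$, are independent; (iii) $\mathbb E[\varepsilon\mid x]=0$ and, for some $\tau>0$, $\mathbb E[e^{t\varepsilon}\mid x]\le e^{\tau^2t^2/2}$ almost surely, for all $t\in\mathbb R$; (iv) for some $\sigma>0$, $\mathbb E[\varepsilon^2\mid x]\ge\sigma^2$ almost surely. Let $(x_1,\varepsilon_1),\dots,(x_n,\varepsilon_n)$ be i.i.d. copies of $(x,\varepsilon)$, let $\beta^*\in\mathcal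 H$ and $y_i=\langle\beta^*,x_i\rangle+\varepsilon_i$. Let $1\le M\le n$ with $M\mid n$, and split the data into $M$ disjoint parts of size $n/M$. Let $\hat\beta_m$ be the minimum norm least squares solution computed from the $m$-th part, i.e. the element of smallest norm among all minimizers $\beta\in\mathcal H$ of $\|\mathbf X_m\beta-\mathbf Y_m\|^2$, where $\mathbf X_m\beta=(\langle x_i,\beta\rangle)_i$ and $\mathbf Y_m=(y_i)_i$, with $i$ running over the $m$-th part. Let $\bar\beta_M=\frac1M\sum_{m=1}^M\hat\beta_m$. Assume general position: for every $m$, almost surely, for every $j$, the orthogonal projections of the $n/M$ inputs of the $m$-th part onto the hyperplane $v_j^\perp$ are linearly independent. For $k\ge0$ with $\lambda_{k+1}>0$ put $$r_k(\Sigma)=\frac{\sum_{j>k}\lambda_j}{\lambda_{k+1}},\qquad R_k(\Sigma)=\frac{\bigl(\sum_{j>k}\lambda_j\bigr)^2}{\sum_{j>k}\lambda_j^2},$$ and for $a>1$ let $k^*=k^*_{n/M}=\min\{k\ge0:\lambda_{k+1}>0,\ r_k(\Sigma)\ge a\,n/M\}$, with $\min\emptyset=\infty$. Theorem. There is a constant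 $c>1$, depending only on $\sigma_x$, and for every $a>1$ there is a constant $c_a>0$, depending only on $a$ and $\sigma_x$, such that, in every setting as above, if $k^*_{n/M}\le\frac{n}{cM}$ (in particular $k^*_{n/M}<\infty$), then with probability at least $1-10\,M\,e^{-\frac1c\frac nM}$ $$\mathbb E_\varepsilon\Bigl[\bigl\|\Sigma^{1/2}(\bar\beta_M-\beta^*)\bigr\|^2\Bigr]\ \ge\ c_a\,\sigma^2\left(\frac{k^*_{n/M}}{n}+\frac{n}{M^2}\,\frac{1}{R_{k^*_{n/M}}(\Sigma)}\right),$$ where $\mathbb E_\varepsilon$ denotes the conditional expectation given the inputs $x_1,\dots,x_n$. -/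

import Mathlib

open MeasureTheory ProbabilityTheory
open scoped ENNReal RealInnerProductSpace

namespace DistRidgeless

noncomputable section

/-! ### Minimum norm least squares -/

section Estimator

variable {H : Type*} [NormedAddCommGroup H] [InnerProductSpace ℝ H]

/-- The data matrix with rows `x 1, …, x N`, as the bounded operator `v ↦ (⟪x i, v⟫)ᵢ`. -/
def dataMatrix {N : ℕ} (x : Fin N → H) : H →L[ℝ] EuclideanSpace ℝ (Fin N) :=
  ((EuclideanSpace.equiv (Fin N) ℝ).symm : (Fin N → ℝ) →L[ℝ] EuclideanSpace ℝ (Fin N)).comp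
    (ContinuousLinearMap.pi fun i => innerSL ℝ (x i))

/-- `β` minimizes the squared residual `‖X β - Y‖²`. -/
def IsLeastSquares {N : ℕ} (x : Fin N → H) (y : EuclideanSpace ℝ (Fin N)) (β : H) : Prop :=
  ∀ β' : H, ‖dataMatrix x β - y‖ ^ 2 ≤ ‖dataMatrix x β' - y‖ ^ 2

/-- `β` has minimal norm among all minimizers of the squared residual. -/
def IsMinNorm {N : ℕ} (x : Fin N → H) (y : EuclideanSpace ℝ (Fin N)) (β : H) : Prop :=
  IsLeastSquares x y β ∧ ∀ β' : H, IsLeastSquares x y β' → ‖β‖ ^ 2 ≤ ‖β'‖ ^ 2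

theorem existsUnique_isMinNorm [CompleteSpace H] {N : ℕ} (x : Fin N → H)
    (y : EuclideanSpace ℝ (Fin N)) : ∃! β : H, IsMinNorm x y β := by
  set X := dataMatrix x with hX
  set R := LinearMap.range (X : H →ₗ[ℝ] EuclideanSpace ℝ (Fin N)) with hR
  set K := LinearMap.ker (X : H →ₗ[ℝ] EuclideanSpace ℝ (Fin N)) with hK
  have : CompleteSpace K := X.isClosed_ker.completeSpace_coe
  set p := R.starProjection y with hp
  have hpR : p ∈ R := Submodule.starProjection_apply_mem _ _
  obtain ⟨b, hb⟩ := hpR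
  have hpy : p - y ∈ Rᗮ := by
    have := R.sub_starProjection_mem_orthogonal y
    simpa using Rᗮ.neg_mem this
  set β₀ := b - K.starProjection b with hβ₀
  have hβK : β₀ ∈ Kᗮ := K.sub_starProjection_mem_orthogonal b
  have hKb : X (K.starProjection b) = 0 := by
    have : K.starProjection b ∈ K := Submodule.starProjection_apply_mem _ _
    exact LinearMap.mem_ker.mp this
  have hXβ : X β₀ = p := by
    rw [hβ₀, map_sub, hKb, sub_zero]; exact hb
  have pyth : ∀ β : H, ‖X β - y‖ ^ 2 = ‖X β - p‖ ^ 2 + ‖p - y‖ ^ 2 := by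
    intro β
    have h1 : X β - p ∈ R := R.sub_mem ⟨β, rfl⟩ ⟨b, hb⟩
    have h0 : ⟪X β - p, p - y⟫ = 0 := Submodule.inner_right_of_mem_orthogonal h1 hpy
    have := norm_add_sq_eq_norm_sq_add_norm_sq_of_inner_eq_zero (X β - p) (p - y) h0
    rw [sub_add_sub_cancel] at this
    nlinarith [this]
  have hLS : ∀ β : H, IsLeastSquares x y β ↔ X β = p := by
    intro β
    constructor
    · intro h
      have h1 := h β₀
      rw [← hX, pyth, pyth β₀, hXβ, sub_self, norm_zero] at h1
      have h2 : ‖X β - p‖ ^ 2 = 0 := le_antisymm (by linarith) (sq_nonneg _)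
      exact sub_eq_zero.mp (norm_eq_zero.mp (pow_eq_zero_iff two_ne_zero |>.mp h2))
    · intro h β'
      rw [← hX, pyth, pyth β', h, sub_self, norm_zero]
      nlinarith [sq_nonneg ‖X β' - p‖]
  have pyth' : ∀ β : H, X β = p → ‖β‖ ^ 2 = ‖β - β₀‖ ^ 2 + ‖β₀‖ ^ 2 := by
    intro β h
    have h1 : β - β₀ ∈ K := by
      simp [hK, h, hXβ]
    have h0 : ⟪β - β₀, β₀⟫ = 0 := Submodule.inner_right_of_mem_orthogonal h1 hβK
    have := norm_add_sq_eq_norm_sq_add_norm_sq_of_inner_eq_zero (β - β₀) β₀ h0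
    rw [sub_add_cancel] at this
    nlinarith [this]
  refine ⟨β₀, ⟨(hLS β₀).2 hXβ, fun β' h => ?_⟩, fun β hβ => ?_⟩
  · rw [pyth' β' ((hLS β').1 h)]
    nlinarith [sq_nonneg ‖β' - β₀‖]
  · have h1 := hβ.2 β₀ ((hLS β₀).2 hXβ)
    rw [pyth' β ((hLS β).1 hβ.1)] at h1
    have h2 : ‖β - β₀‖ ^ 2 = 0 := le_antisymm (by linarith) (sq_nonneg _)
    exact sub_eq_zero.mp (norm_eq_zero.mp (pow_eq_zero_iff two_ne_zero |>.mp h2))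

/-- The minimum norm least squares estimator `Xᵀ (X Xᵀ)† Y`. -/
def minNormEstimator [CompleteSpace H] {N : ℕ} (x : Fin N → H)
    (y : EuclideanSpace ℝ (Fin N)) : H :=
  (existsUnique_isMinNorm x y).choose

/-- The uniform average of the `M` local minimum norm estimators. The data `(x i, y i)` are split
evenly by `e`, the sample with number `e (m, i)` being the `i`-th sample of node `m`. -/
def averagedEstimator [CompleteSpace H] {n M N : ℕ} (e : Fin M × Fin N ≃ Fin n)
    (x : Fin n → H) (y : Fin n → ℝ) : H :=
  (M : ℝ)⁻¹ • ∑ m : Fin M,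
    minNormEstimator (fun i : Fin N => x (e (m, i))) (WithLp.toLp 2 fun i => y (e (m, i)))

end Estimator

/-! ### Effective ranks and effective dimension

Eigenvalues are numbered from `0`: `lam j` is the `(j + 1)`-st largest eigenvalue, so that
`∑' j, lam (k + j)` is the sum of all eigenvalues but the `k` largest. -/

/-- The effective rank `r_k` (meant for `0 < lam k`). -/
def effRank (lam : ℕ → ℝ) (k : ℕ) : ℝ := (∑' j, lam (k + j)) / lam k

/-- The effective rank `R_k` (meant for `0 < lam k`). -/
def effRankSq (lam : ℕ → ℝ) (k : ℕ) : ℝ := (∑' j, lam (k + j)) ^ 2 / ∑' j, lam (k + j) ^ 2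

/-- The effective dimension: the least `k ≥ 0` with `r_k ≥ a N`, and `∞` if there is none. -/
def effDim (lam : ℕ → ℝ) (a N : ℝ) : ℕ∞ :=
  ⨅ (k : ℕ) (_ : 0 < lam k ∧ a * N ≤ effRank lam k), (k : ℕ∞)

/-! ### Distributional assumptions -/

section Design

variable {H : Type*} [NormedAddCommGroup H] [InnerProductSpace ℝ H]

/-- `z` is `(s², Γ)`-subgaussian. -/
def IsSubgaussian {Ω : Type*} [MeasurableSpace Ω] (μ : Measure Ω) (z : Ω → H) (s : ℝ)
    (Γ : H → H) : Prop :=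
  ∀ v : H, Integrable (fun ω => Real.exp ⟪v, z ω - ∫ ω', z ω' ∂μ⟫) μ ∧
    ∫ ω, Real.exp ⟪v, z ω - ∫ ω', z ω' ∂μ⟫ ∂μ ≤ Real.exp (s ^ 2 / 2 * ⟪Γ v, v⟫)

variable [MeasurableSpace H]

/-- The covariance operator `Σ u = E[⟪u, x⟫ x]`; `P` is the joint law of `(x, ε)`. -/
def covOp (P : Measure (H × ℝ)) (u : H) : H := ∫ p, ⟪u, p.1⟫ • p.1 ∂P

/-- The σ-algebra generated by the input `x` on the space of pairs `(x, ε)`. -/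
abbrev inputAlgebra (H : Type*) [MeasurableSpace H] : MeasurableSpace (H × ℝ) :=
  MeasurableSpace.comap Prod.fst inferInstance

/-- The assumptions on the design and on the noise, for the joint law `P` of `(x, ε)`. The family
`v` is an orthonormal basis with `d = dim H` elements (`d = ⊤` if the dimension is infinite), and
`lam` lists the eigenvalues in decreasing order, continued by `0` if `d` is finite. -/
structure DesignAssumption (P : Measure (H × ℝ)) (d : ℕ∞)
    (v : HilbertBasis {j : ℕ // (j : ℕ∞) < d} ℝ H) (lam : ℕ → ℝ) (σx τ : ℝ) : Prop where
  input_sq_integrable : MemLp (fun p : H × ℝ => p.1) 2 P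
  input_centered : ∫ p, p.1 ∂P = 0
  input_subgaussian : IsSubgaussian P (fun p : H × ℝ => p.1) σx (covOp P)
  input_indep : iIndepFun (fun j (p : H × ℝ) => ⟪v j, p.1⟫) P
  eigenvector : ∀ j, covOp P (v j) = lam j • v j
  eigenvalue_antitone : Antitone lam
  eigenvalue_zero : ∀ j : ℕ, d ≤ j → lam j = 0
  noise_integrable : Integrable (fun p : H × ℝ => p.2) P
  noise_centered : P[fun p : H × ℝ => p.2 | inputAlgebra H] =ᵐ[P] 0
  noise_subgaussian : ∀ t : ℝ, Integrable (fun p : H × ℝ => Real.exp (t * p.2)) P ∧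
    P[fun p : H × ℝ => Real.exp (t * p.2) | inputAlgebra H]
      ≤ᵐ[P] fun _ => Real.exp (τ ^ 2 / 2 * t ^ 2)

/-- The conditional noise variance is bounded below: `E[ε² | x] ≥ σ²` almost surely. -/
def NoiseLowerBound (P : Measure (H × ℝ)) (σ : ℝ) : Prop :=
  (fun _ => σ ^ 2) ≤ᵐ[P] P[fun p : H × ℝ => p.2 ^ 2 | inputAlgebra H]

/-- General position: for each node `m`, almost surely, the orthogonal projections of its
`N` inputs onto the hyperplane `(v j)ᗮ` are linearly independent, for every `j`. -/
def GeneralPosition {Ω : Type*} [MeasurableSpace Ω] (μ : Measure Ω) {d : ℕ∞}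
    (v : HilbertBasis {j : ℕ // (j : ℕ∞) < d} ℝ H) {n M N : ℕ} (e : Fin M × Fin N ≃ Fin n)
    (x : Fin n → Ω → H) : Prop :=
  ∀ m : Fin M, ∀ᵐ ω ∂μ, ∀ j,
    LinearIndependent ℝ fun i : Fin N => (ℝ ∙ (v j : H))ᗮ.starProjection (x (e (m, i)) ω)

/-- `Σ^{1/2}`, for `Σ` with the orthonormal eigenbasis `v` and the eigenvalues `lam`. -/
def covSqrt {d : ℕ∞} (v : HilbertBasis {j : ℕ // (j : ℕ∞) < d} ℝ H) (lam : ℕ → ℝ) (u : H) : H :=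
  ∑' j : {j : ℕ // (j : ℕ∞) < d}, (√(lam j) * ⟪v j, u⟫) • v j

/-- The conditional excess risk `E_ε[‖Σ^{1/2} (β̄_M - β*)‖²]` of the averaged estimator given the
inputs, for the responses `y i = ⟪β*, x i⟫ + ε i`. It is a conditional expectation with values in
`[0, ∞]`: the risk need not be integrable over the inputs. -/
def condExcessRisk [CompleteSpace H] {Ω : Type*} [MeasurableSpace Ω] (μ : Measure Ω) {d : ℕ∞}
    (v : HilbertBasis {j : ℕ // (j : ℕ∞) < d} ℝ H) (lam : ℕ → ℝ) {n M N : ℕ}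
    (e : Fin M × Fin N ≃ Fin n) (x : Fin n → Ω → H) (ε : Fin n → Ω → ℝ) (βstar : H) :
    Ω → ℝ≥0∞ :=
  condLExp (MeasurableSpace.comap (fun ω i => x i ω) MeasurableSpace.pi) μ fun ω =>
    ENNReal.ofReal (‖covSqrt v lam
      (averagedEstimator e (fun i => x i ω) (fun i => ⟪βstar, x i ω⟫ + ε i ω) - βstar)‖ ^ 2)

end Design

end

end DistRidgeless

open DistRidgeless

namespace DistRidgeless

/-! ### Exponential moments and tails of sums of squares. -/

section Gaussian

theorem lintegral_exp_mul_gaussianReal (t : ℝ) :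
    ∫⁻ g, ENNReal.ofReal (Real.exp (t * g)) ∂gaussianReal 0 1 =
      ENNReal.ofReal (Real.exp (t ^ 2 / 2)) := by
  rw [← ofReal_integral_eq_lintegral_ofReal (integrable_exp_mul_gaussianReal t)
    (ae_of_all _ fun _ => (Real.exp_pos _).le)]
  have := mgf_gaussianReal (X := id) (p := gaussianReal 0 1) (μ := 0) (v := 1) (by simp) t
  simp only [mgf, id] at this
  rw [this]; simp

/-- After squaring, this is `(1 - x) exp (2 x) ≥ (1 - x) (1 + 2 x + 2 x²) = 1 + x - 2 x³ ≥ 1`. -/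
theorem inv_sqrt_one_sub_le_exp {x : ℝ} (h0 : 0 ≤ x) (h1 : x ≤ 1 / 2) :
    √(1 / (1 - x)) ≤ Real.exp x := by
  rw [Real.sqrt_le_left (Real.exp_pos _).le, ← Real.exp_nat_mul,
    div_le_iff₀ (by linarith)]
  have h2 := Real.quadratic_le_exp_of_nonneg (x := 2 * x) (by linarith)
  push_cast
  nlinarith [mul_nonneg h0 h0]

theorem lintegral_exp_sq_gaussianReal_le {r : ℝ} (h0 : 0 ≤ r) (h1 : r ≤ 1 / 4) :
    ∫⁻ g, ENNReal.ofReal (Real.exp (r * g ^ 2)) ∂gaussianReal 0 1 ≤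
      ENNReal.ofReal (Real.exp (2 * r)) := by
  have hb : 0 < 1 / 2 - r := by linarith
  have hpt : ∀ g : ℝ, gaussianPDFReal 0 1 g * Real.exp (r * g ^ 2)
      = (√(2 * Real.pi))⁻¹ * Real.exp (-(1 / 2 - r) * g ^ 2) := by
    intro g
    simp only [gaussianPDFReal, NNReal.coe_one, mul_one, sub_zero]
    rw [mul_assoc, ← Real.exp_add]; congr 2; ring
  rw [gaussianReal_of_var_ne_zero _ one_ne_zero,
    lintegral_withDensity_eq_lintegral_mul _ (measurable_gaussianPDF 0 1) (by fun_prop)]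
  have : ∀ g : ℝ, (gaussianPDF 0 1 * fun g => ENNReal.ofReal (Real.exp (r * g ^ 2))) g
      = ENNReal.ofReal ((√(2 * Real.pi))⁻¹ * Real.exp (-(1 / 2 - r) * g ^ 2)) := by
    intro g
    rw [← hpt, ENNReal.ofReal_mul (gaussianPDFReal_nonneg _ _ _)]; rfl
  simp_rw [this]
  rw [← ofReal_integral_eq_lintegral_ofReal
    ((integrable_exp_neg_mul_sq hb).const_mul _) (ae_of_all _ fun _ => by positivity),
    integral_const_mul, integral_gaussian]
  refine ENNReal.ofReal_le_ofReal ?_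
  refine le_trans (le_of_eq ?_) (inv_sqrt_one_sub_le_exp (x := 2 * r) (by linarith) (by linarith))
  rw [← Real.sqrt_inv, ← Real.sqrt_mul (by positivity)]
  congr 1
  have := Real.pi_pos
  have h3 : 1 - 2 * r ≠ 0 := by linarith
  field_simp

variable {Ω ι : Type*} [MeasurableSpace Ω] [Fintype ι]

theorem lintegral_pi_prod_comp {X : ι → Type*} [∀ i, MeasurableSpace (X i)]
    (ν : ∀ i, Measure (X i)) [∀ i, IsProbabilityMeasure (ν i)] (f : ∀ i, X i → ℝ≥0∞)
    (hf : ∀ i, Measurable (f i)) :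
    ∫⁻ x, ∏ i, f i (x i) ∂Measure.pi ν = ∏ i, ∫⁻ y, f i y ∂ν i := by
  have h := lintegral_prod_eq_prod_lintegral_of_indepFun Finset.univ
    (fun i (x : ∀ i, X i) => f i (x i))
    (iIndepFun_pi (μ := ν) fun i => (hf i).aemeasurable) (fun i => (hf i).comp (measurable_pi_apply i))
  rw [h]
  refine Finset.prod_congr rfl fun i _ => ?_
  exact (measurePreserving_eval ν i).lintegral_comp (hf i)

/-- Exponential moment of the squared norm of a subgaussian vector, by Gaussian randomization. -/
theorem lintegral_exp_sum_sq_le (μ : Measure Ω) [SFinite μ] (a : ι → Ω → ℝ)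
    (ha : ∀ i, Measurable (a i)) (q : ι → ℝ) (hq : ∀ i, 0 ≤ q i)
    (hmgf : ∀ θ : ι → ℝ, ∫⁻ ω, ENNReal.ofReal (Real.exp (∑ i, θ i * a i ω)) ∂μ ≤
      ENNReal.ofReal (Real.exp (1 / 2 * ∑ i, q i * θ i ^ 2)))
    {s : ℝ} (hs : 0 ≤ s) (hsq : ∀ i, s * q i ≤ 1 / 4) :
    ∫⁻ ω, ENNReal.ofReal (Real.exp (s * ∑ i, a i ω ^ 2)) ∂μ ≤
      ENNReal.ofReal (Real.exp (2 * s * ∑ i, q i)) := by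
  have hexp : ∀ f : ι → ℝ, ENNReal.ofReal (Real.exp (∑ i, f i))
      = ∏ i, ENNReal.ofReal (Real.exp (f i)) := by
    intro f
    rw [Real.exp_sum, ENNReal.ofReal_prod_of_nonneg fun i _ => (Real.exp_pos _).le]
  set γ : ι → Measure ℝ := fun _ => gaussianReal 0 1 with hγ
  -- The scale `√(2 s)` makes the Gaussian average of `exp (√(2 s) g a)` equal to `exp (s a²)`.
  -- After exchanging the integrals, only the joint moment generating function of the `a i` is
  -- needed, not their independence.
  have hs2 : √(2 * s) ^ 2 = 2 * s := Real.sq_sqrt (by linarith)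
  have h1 : ∀ ω, ENNReal.ofReal (Real.exp (s * ∑ i, a i ω ^ 2))
      = ∫⁻ g, ENNReal.ofReal (Real.exp (∑ i, √(2 * s) * g i * a i ω)) ∂Measure.pi γ := by
    intro ω
    simp_rw [hexp]
    rw [lintegral_pi_prod_comp γ
      (fun i y => ENNReal.ofReal (Real.exp (√(2 * s) * y * a i ω))) (fun i => by fun_prop),
      Finset.mul_sum, hexp]
    refine Finset.prod_congr rfl fun i _ => ?_
    have := lintegral_exp_mul_gaussianReal (√(2 * s) * a i ω)
    rw [mul_pow, hs2] at this
    rw [show s * a i ω ^ 2 = 2 * s * a i ω ^ 2 / 2 by ring, ← this]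
    refine lintegral_congr fun g => ?_
    congr 2; ring
  simp_rw [h1]
  rw [lintegral_lintegral_swap (by fun_prop)]
  calc ∫⁻ g, ∫⁻ ω, ENNReal.ofReal (Real.exp (∑ i, √(2 * s) * g i * a i ω)) ∂μ ∂Measure.pi γ
      ≤ ∫⁻ g : ι → ℝ, ∏ i, ENNReal.ofReal (Real.exp (s * q i * g i ^ 2)) ∂Measure.pi γ := by
        refine lintegral_mono fun g => (hmgf fun i => √(2 * s) * g i).trans (le_of_eq ?_)
        rw [← hexp, Finset.mul_sum]
        congr 2
        refine Finset.sum_congr rfl fun i _ => ?_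
        rw [mul_pow, hs2]; ring
    _ = ∏ i, ∫⁻ g, ENNReal.ofReal (Real.exp (s * q i * g ^ 2)) ∂gaussianReal 0 1 :=
        lintegral_pi_prod_comp γ
          (fun i y => ENNReal.ofReal (Real.exp (s * q i * y ^ 2))) (fun i => by fun_prop)
    _ ≤ ∏ i, ENNReal.ofReal (Real.exp (2 * (s * q i))) :=
        Finset.prod_le_prod' fun i _ =>
          lintegral_exp_sq_gaussianReal_le (mul_nonneg hs (hq i)) (hsq i)
    _ = ENNReal.ofReal (Real.exp (2 * s * ∑ i, q i)) := by
        rw [← hexp, Finset.mul_sum]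
        congr 2
        exact Finset.sum_congr rfl fun i _ => by ring

/-- Markov's inequality for the exponential of a real random variable. -/
theorem measure_ge_le_exp (μ : Measure Ω) (Z : Ω → ℝ) (hZ : Measurable Z) {s b τ : ℝ} (hs : 0 ≤ s)
    (h : ∫⁻ ω, ENNReal.ofReal (Real.exp (s * Z ω)) ∂μ ≤ ENNReal.ofReal (Real.exp b)) :
    μ {ω | τ ≤ Z ω} ≤ ENNReal.ofReal (Real.exp (b - s * τ)) := by
  have h1 := (mul_meas_ge_le_lintegral₀ (μ := μ)
    (f := fun ω => ENNReal.ofReal (Real.exp (s * Z ω))) (by fun_prop)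
    (ENNReal.ofReal (Real.exp (s * τ)))).trans h
  have h2 : μ {ω | τ ≤ Z ω} ≤ μ {ω | ENNReal.ofReal (Real.exp (s * τ)) ≤
      ENNReal.ofReal (Real.exp (s * Z ω))} := by
    refine measure_mono fun ω hω => ?_
    exact ENNReal.ofReal_le_ofReal (Real.exp_le_exp.2 (mul_le_mul_of_nonneg_left hω hs))
  refine h2.trans ?_
  rw [Real.exp_sub, ENNReal.ofReal_div_of_pos (Real.exp_pos _), ENNReal.le_div_iff_mul_le]
  · rwa [mul_comm]
  · left; simpa using Real.exp_pos _
  · left; exact ENNReal.ofReal_ne_top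

theorem measure_sum_sq_ge_le (μ : Measure Ω) [SFinite μ] (a : ι → Ω → ℝ)
    (ha : ∀ i, Measurable (a i)) (q : ι → ℝ) (hq : ∀ i, 0 ≤ q i)
    (hmgf : ∀ θ : ι → ℝ, ∫⁻ ω, ENNReal.ofReal (Real.exp (∑ i, θ i * a i ω)) ∂μ ≤
      ENNReal.ofReal (Real.exp (1 / 2 * ∑ i, q i * θ i ^ 2)))
    {s : ℝ} (hs : 0 ≤ s) (hsq : ∀ i, s * q i ≤ 1 / 4) (τ : ℝ) :
    μ {ω | τ ≤ ∑ i, a i ω ^ 2} ≤ ENNReal.ofReal (Real.exp (2 * s * ∑ i, q i - s * τ)) :=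
  measure_ge_le_exp μ _ (by fun_prop) hs (lintegral_exp_sum_sq_le μ a ha q hq hmgf hs hsq)

end Gaussian

/-! ### Concentration of a single column. -/

section Array

variable {Ω J : Type*} {N : ℕ}

/-- A column of an array, as a random Euclidean vector. -/
def arrayCol (U : Fin N → J → Ω → ℝ) (j : J) (ω : Ω) : EuclideanSpace ℝ (Fin N) :=
  WithLp.toLp 2 fun i => U i j ω

theorem norm_arrayCol_sq (U : Fin N → J → Ω → ℝ) (j : J) (ω : Ω) :
    ‖arrayCol U j ω‖ ^ 2 = ∑ i, U i j ω ^ 2 := by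
  simp [EuclideanSpace.norm_sq_eq, arrayCol]

theorem inner_arrayCol (U : Fin N → J → Ω → ℝ) (j : J) (ω : Ω) (t : EuclideanSpace ℝ (Fin N)) :
    ⟪arrayCol U j ω, t⟫ = ∑ i, t i * U i j ω := by
  simp [PiLp.inner_apply, arrayCol]

variable [MeasurableSpace Ω]

/-- An array with independent entries; those of column `j` are subgaussian with variance
`lam j` and variance proxy `s² lam j`. -/
structure IndepSubgaussianArray (μ : Measure Ω) (U : Fin N → J → Ω → ℝ) (lam : J → ℝ) (s : ℝ) :
    Prop where
  measurable : ∀ i j, Measurable (U i j)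
  indep : iIndepFun (fun (p : Fin N × J) ω => U p.1 p.2 ω) μ
  nonneg : ∀ j, 0 ≤ lam j
  mgf_le : ∀ i j (θ : ℝ), ∫⁻ ω, ENNReal.ofReal (Real.exp (θ * U i j ω)) ∂μ ≤
    ENNReal.ofReal (Real.exp (s ^ 2 / 2 * (lam j * θ ^ 2)))
  lintegral_sq : ∀ i j, ∫⁻ ω, ENNReal.ofReal (U i j ω ^ 2) ∂μ = ENNReal.ofReal (lam j)

variable {μ : Measure Ω} {U : Fin N → J → Ω → ℝ} {lam : J → ℝ} {s : ℝ}

namespace IndepSubgaussianArray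

theorem measurable_arrayCol (h : IndepSubgaussianArray μ U lam s) (j : J) :
    Measurable (arrayCol U j) :=
  (WithLp.measurable_toLp 2 _).comp (measurable_pi_iff.2 fun i => h.measurable i j)

theorem mgf_sum_le (h : IndepSubgaussianArray μ U lam s) (T : Finset (Fin N × J))
    (θ : Fin N × J → ℝ) :
    ∫⁻ ω, ENNReal.ofReal (Real.exp (∑ p ∈ T, θ p * U p.1 p.2 ω)) ∂μ ≤
      ENNReal.ofReal (Real.exp (s ^ 2 / 2 * ∑ p ∈ T, lam p.2 * θ p ^ 2)) := by
  have hexp : ∀ f : Fin N × J → ℝ, ENNReal.ofReal (Real.exp (∑ i ∈ T, f i))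
      = ∏ i ∈ T, ENNReal.ofReal (Real.exp (f i)) := by
    intro f
    rw [Real.exp_sum, ENNReal.ofReal_prod_of_nonneg fun i _ => (Real.exp_pos _).le]
  rw [Finset.mul_sum]
  simp_rw [hexp]
  have hm : ∀ p : Fin N × J, Measurable fun y : ℝ => ENNReal.ofReal (Real.exp (θ p * y)) :=
    fun p => by fun_prop
  have := lintegral_prod_eq_prod_lintegral_of_indepFun T
    (fun p ω => ENNReal.ofReal (Real.exp (θ p * U p.1 p.2 ω)))
    (h.indep.comp (fun p y => ENNReal.ofReal (Real.exp (θ p * y))) hm)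
    (fun p => (hm p).comp (h.measurable _ _))
  rw [this]
  exact Finset.prod_le_prod' fun p _ => h.mgf_le _ _ _

theorem mgf_inner_le (h : IndepSubgaussianArray μ U lam s) (j : J)
    (t : EuclideanSpace ℝ (Fin N)) :
    ∫⁻ ω, ENNReal.ofReal (Real.exp ⟪arrayCol U j ω, t⟫) ∂μ ≤
      ENNReal.ofReal (Real.exp (s ^ 2 / 2 * (lam j * ‖t‖ ^ 2))) := by
  have := h.mgf_sum_le (Finset.univ ×ˢ {j}) fun p => t p.1
  simp only [Finset.sum_product, Finset.sum_singleton] at this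
  simp_rw [inner_arrayCol]
  refine this.trans (le_of_eq ?_)
  rw [EuclideanSpace.norm_sq_eq, ← Finset.mul_sum]
  simp

/-- The projection of a column onto a subspace of small dimension is small. -/
theorem measure_projection_ge_le [SFinite μ] (h : IndepSubgaussianArray μ U lam s) (hs : 0 < s)
    {j : J} (hj : 0 < lam j) (W : Submodule ℝ (EuclideanSpace ℝ (Fin N))) (τ : ℝ) :
    μ {ω | τ * lam j ≤ ‖W.starProjection (arrayCol U j ω)‖ ^ 2} ≤
      ENNReal.ofReal (Real.exp (Module.finrank ℝ W / 2 - τ / (4 * s ^ 2))) := by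
  set b := stdOrthonormalBasis ℝ W with hb
  have hsl : 0 < s ^ 2 * lam j := by positivity
  -- Coordinates in an orthonormal basis of `W`. The exponent `1 / (4 s² lam j)` is the largest one
  -- that the Gaussian moment bound permits.
  have key := measure_sum_sq_ge_le μ (fun l ω => ⟪arrayCol U j ω, (b l : EuclideanSpace ℝ (Fin N))⟫)
    (fun l => (h.measurable_arrayCol j).inner_const) (fun _ => s ^ 2 * lam j) (fun _ => hsl.le)
    ?_ (s := 1 / (4 * (s ^ 2 * lam j))) (by positivity) (fun _ => le_of_eq (by field_simp)) (τ * lam j)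
  · refine (measure_mono fun ω hω => ?_).trans (key.trans (ENNReal.ofReal_le_ofReal ?_))
    · simp only [Set.mem_ofPred_eq] at hω ⊢
      refine hω.trans (le_of_eq ?_)
      rw [Submodule.starProjection_apply, ← Submodule.coe_norm, ← b.sum_sq_norm_inner_right]
      refine Finset.sum_congr rfl fun l _ => ?_
      rw [Real.norm_eq_abs, sq_abs, Submodule.coe_inner, ← Submodule.starProjection_apply,
        real_inner_comm, Submodule.inner_starProjection_left_eq_right,
        Submodule.starProjection_eq_self_iff.2 (b l).2]
    · refine Real.exp_le_exp.2 (le_of_eq ?_)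
      simp only [Finset.sum_const, Finset.card_univ, Fintype.card_fin, nsmul_eq_mul]
      field_simp
      ring
  · intro θ
    have := h.mgf_inner_le j (∑ l, θ l • (b l : EuclideanSpace ℝ (Fin N)))
    simp only [inner_sum, inner_smul_right] at this
    refine this.trans (le_of_eq ?_)
    congr 2
    have hn : ‖∑ l, θ l • (b l : EuclideanSpace ℝ (Fin N))‖ ^ 2 = ∑ l, θ l ^ 2 := by
      have := b.orthonormal.comp_linearIsometry W.subtypeₗᵢ
      rw [← real_inner_self_eq_norm_sq]
      have h2 := this.inner_sum θ θ Finset.univ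
      refine h2.trans (Finset.sum_congr rfl fun l _ => ?_)
      simp [sq]
    rw [hn, ← Finset.mul_sum]; ring

/-- The case `W = ⊤`; the factor `6` gives `N / 2 - 6 N / 4 = -N`. -/
theorem measure_norm_sq_ge_le [SFinite μ] (h : IndepSubgaussianArray μ U lam s) (hs : 0 < s)
    {j : J} (hj : 0 < lam j) :
    μ {ω | 6 * s ^ 2 * N * lam j ≤ ‖arrayCol U j ω‖ ^ 2} ≤ ENNReal.ofReal (Real.exp (-N)) := by
  have := h.measure_projection_ge_le hs hj ⊤ (6 * s ^ 2 * N)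
  simp only [Submodule.starProjection_top, ContinuousLinearMap.id_apply, finrank_top,
    finrank_euclideanSpace, Fintype.card_fin] at this
  refine this.trans (ENNReal.ofReal_le_ofReal (Real.exp_le_exp.2 (le_of_eq ?_)))
  field_simp
  ring

/-- Taylor's bound `exp (-r y) ≤ 1 - r y + (r y)² / 2` at `y = U²`. The quadratic term is absorbed
by `y² / 2 ≤ A² exp (y / A)`, and at `A = 4 s² lam j` the mean of `exp (U² / A)` is at most `exp (1
/ 2) ≤ 2`; hence `32 = 2 * 4²`. -/
theorem lintegral_exp_neg_sq_le [IsProbabilityMeasure μ] (h : IndepSubgaussianArray μ U lam s)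
    (hs : 0 < s) {j : J} (hj : 0 < lam j) (i : Fin N) {r : ℝ} (hr : 0 ≤ r) :
    ∫⁻ ω, ENNReal.ofReal (Real.exp (-r * U i j ω ^ 2)) ∂μ ≤
      ENNReal.ofReal (Real.exp (-(r * lam j) + 32 * s ^ 4 * (r * lam j) ^ 2)) := by
  set A := 4 * (s ^ 2 * lam j) with hA
  have hA0 : 0 < A := by positivity
  have hm := h.measurable i j
  have h1 : ∫⁻ ω, ENNReal.ofReal (Real.exp (1 / A * U i j ω ^ 2)) ∂μ ≤
      ENNReal.ofReal (Real.exp (1 / 2)) := by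
    have := lintegral_exp_sum_sq_le μ (fun (_ : Unit) ω => U i j ω) (fun _ => hm)
      (fun _ => s ^ 2 * lam j) (fun _ => by positivity)
      (fun θ => by
        simp only [Finset.univ_unique, Finset.sum_singleton]
        refine (h.mgf_le i j _).trans (le_of_eq ?_)
        congr 2; ring) (s := 1 / A) (by positivity) (fun _ => le_of_eq (by rw [hA]; field_simp))
    simp only [Finset.univ_unique, Finset.sum_singleton] at this
    refine this.trans (le_of_eq ?_)
    congr 2
    rw [hA]; field_simp; ring
  have hpt : ∀ y : ℝ, 0 ≤ y → Real.exp (-r * y) + r * y ≤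
      1 + r ^ 2 * A ^ 2 * Real.exp (1 / A * y) := by
    intro y hy
    have e1 : Real.exp (-r * y) ≤ 1 - r * y + (r * y) ^ 2 / 2 := by
      have hx : 0 ≤ r * y := by positivity
      have q1 := Real.quadratic_le_exp_of_nonneg hx
      have q2 : Real.exp (-r * y) = (Real.exp (r * y))⁻¹ := by rw [← Real.exp_neg]; ring_nf
      rw [q2, inv_le_iff_one_le_mul₀ (Real.exp_pos _)]
      have q3 : 0 ≤ 1 - r * y + (r * y) ^ 2 / 2 := by nlinarith [sq_nonneg (r * y - 1)]
      nlinarith [mul_le_mul_of_nonneg_left q1 q3, pow_nonneg hx 4]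
    have e2 := Real.quadratic_le_exp_of_nonneg (x := 1 / A * y) (by positivity)
    have e3 : y ^ 2 / 2 ≤ A ^ 2 * Real.exp (1 / A * y) := by
      have : (1 / A * y) ^ 2 / 2 ≤ Real.exp (1 / A * y) := by
        have : 0 ≤ 1 / A * y := by positivity
        linarith
      calc y ^ 2 / 2 = A ^ 2 * ((1 / A * y) ^ 2 / 2) := by field_simp
        _ ≤ _ := by gcongr
    nlinarith [mul_le_mul_of_nonneg_left e3 (sq_nonneg r)]
  have h2 : ∫⁻ ω, ENNReal.ofReal (Real.exp (-r * U i j ω ^ 2)) ∂μ + ENNReal.ofReal (r * lam j) ≤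
      ENNReal.ofReal (1 + r ^ 2 * A ^ 2 * Real.exp (1 / 2)) := by
    rw [ENNReal.ofReal_mul hr, ← h.lintegral_sq i j, ← lintegral_const_mul _ (by fun_prop),
      ← lintegral_add_left (by fun_prop)]
    calc _ ≤ ∫⁻ ω, (1 + ENNReal.ofReal (r ^ 2 * A ^ 2) *
          ENNReal.ofReal (Real.exp (1 / A * U i j ω ^ 2))) ∂μ := by
          refine lintegral_mono fun ω => ?_
          rw [← ENNReal.ofReal_mul hr, ← ENNReal.ofReal_mul (by positivity), ← ENNReal.ofReal_one,
            ← ENNReal.ofReal_add (Real.exp_pos _).le (by positivity),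
            ← ENNReal.ofReal_add zero_le_one (by positivity)]
          exact ENNReal.ofReal_le_ofReal (hpt _ (sq_nonneg _))
      _ = 1 + ENNReal.ofReal (r ^ 2 * A ^ 2) *
          ∫⁻ ω, ENNReal.ofReal (Real.exp (1 / A * U i j ω ^ 2)) ∂μ := by
          rw [lintegral_add_left (by fun_prop), lintegral_const_mul _ (by fun_prop)]; simp
      _ ≤ 1 + ENNReal.ofReal (r ^ 2 * A ^ 2) * ENNReal.ofReal (Real.exp (1 / 2)) := by gcongr
      _ = _ := by
          rw [← ENNReal.ofReal_mul (by positivity), ← ENNReal.ofReal_one,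
            ← ENNReal.ofReal_add zero_le_one (by positivity)]
  have h3 : ∫⁻ ω, ENNReal.ofReal (Real.exp (-r * U i j ω ^ 2)) ∂μ ≤
      ENNReal.ofReal (1 + r ^ 2 * A ^ 2 * Real.exp (1 / 2)) - ENNReal.ofReal (r * lam j) :=
    ENNReal.le_sub_of_add_le_right ENNReal.ofReal_ne_top h2
  rw [← ENNReal.ofReal_sub _ (by positivity)] at h3
  refine h3.trans (ENNReal.ofReal_le_ofReal ?_)
  have h4 := Real.add_one_le_exp (-(r * lam j) + 32 * s ^ 4 * (r * lam j) ^ 2)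
  have h5 : Real.exp (1 / 2) ≤ 2 := by
    have := Real.exp_bound' (x := 1 / 2) (by norm_num) (by norm_num) (n := 2) (by norm_num)
    norm_num [Finset.sum_range_succ, Nat.factorial] at this ⊢
    linarith
  have h6 : r ^ 2 * A ^ 2 * Real.exp (1 / 2) ≤ r ^ 2 * A ^ 2 * 2 := by gcongr
  have h7 : r ^ 2 * A ^ 2 * 2 = 32 * s ^ 4 * (r * lam j) ^ 2 := by rw [hA]; ring
  linarith

theorem measure_norm_sq_le_le [IsProbabilityMeasure μ] (h : IndepSubgaussianArray μ U lam s)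
    (hs : 0 < s) {j : J} (hj : 0 < lam j) :
    μ {ω | ‖arrayCol U j ω‖ ^ 2 ≤ N / 2 * lam j} ≤
      ENNReal.ofReal (Real.exp (-(N / (512 * s ^ 4)))) := by
  -- The minimizer of `-(r lam j) / 2 + 32 s⁴ (r lam j)²`, the Chernoff exponent per sample.
  set r := 1 / (128 * s ^ 4 * lam j) with hr
  have hr0 : 0 ≤ r := by positivity
  have hind : iIndepFun (fun i ω => U i j ω) μ :=
    h.indep.precomp (g := fun i => (i, j)) (fun a b hab => (Prod.mk.inj hab).1)
  have hm : ∀ i : Fin N, Measurable fun y : ℝ => ENNReal.ofReal (Real.exp (-r * y ^ 2)) :=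
    fun i => by fun_prop
  have h1 : ∫⁻ ω, ENNReal.ofReal (Real.exp (r * -‖arrayCol U j ω‖ ^ 2)) ∂μ ≤
      ENNReal.ofReal (Real.exp (N * (-(r * lam j) + 32 * s ^ 4 * (r * lam j) ^ 2))) := by
    have := lintegral_prod_eq_prod_lintegral_of_indepFun Finset.univ
      (fun i ω => ENNReal.ofReal (Real.exp (-r * U i j ω ^ 2)))
      (hind.comp (fun i y => ENNReal.ofReal (Real.exp (-r * y ^ 2))) hm)
      (fun i => (hm i).comp (h.measurable _ _))
    calc _ = ∫⁻ ω, ∏ i, ENNReal.ofReal (Real.exp (-r * U i j ω ^ 2)) ∂μ := by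
          refine lintegral_congr fun ω => ?_
          rw [← ENNReal.ofReal_prod_of_nonneg fun i _ => (Real.exp_pos _).le, ← Real.exp_sum,
            norm_arrayCol_sq, ← Finset.mul_sum]
          congr 2; ring
      _ ≤ ∏ i : Fin N, ENNReal.ofReal
            (Real.exp (-(r * lam j) + 32 * s ^ 4 * (r * lam j) ^ 2)) := by
          rw [this]
          exact Finset.prod_le_prod' fun i _ => h.lintegral_exp_neg_sq_le hs hj i hr0
      _ = _ := by
          rw [Finset.prod_const, ← ENNReal.ofReal_pow (Real.exp_pos _).le, ← Real.exp_nat_mul]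
          simp
  have h2 := measure_ge_le_exp μ _ ((h.measurable_arrayCol j).norm.pow_const 2).neg
    (τ := -(N / 2 * lam j)) hr0 h1
  simp only [Pi.neg_apply, neg_le_neg_iff] at h2
  refine h2.trans (ENNReal.ofReal_le_ofReal (Real.exp_le_exp.2 (le_of_eq ?_)))
  rw [hr]; field_simp; ring

end IndepSubgaussianArray
end Array
-- Nets of the Euclidean ball and operator norms.
section Net

/-- The Euclidean unit ball has a `1/2`-net with at most `5 ^ N` elements. -/
theorem exists_half_net (N : ℕ) : ∃ A : Finset (EuclideanSpace ℝ (Fin N)), A.card ≤ 5 ^ N ∧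
    (∀ c ∈ A, ‖c‖ ≤ 1) ∧ ∀ t : EuclideanSpace ℝ (Fin N), ‖t‖ ≤ 1 → ∃ c ∈ A, ‖t - c‖ ≤ 1 / 2 := by
  classical
  set Sep : Finset (EuclideanSpace ℝ (Fin N)) → Prop := fun A =>
    (∀ c ∈ A, ‖c‖ ≤ 1) ∧ ∀ c ∈ A, ∀ d ∈ A, c ≠ d → 1 / 2 < ‖c - d‖ with hSep
  have hcard : ∀ A, Sep A → A.card ≤ 5 ^ N := by
    intro A hA
    have hinj : Function.Injective fun c : EuclideanSpace ℝ (Fin N) => (2 : ℝ) • c :=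
      smul_right_injective _ two_ne_zero
    -- Doubling puts the points in the ball of radius `2` at mutual distance at least `1`, where a
    -- volume count gives `5 ^ N`.
    have := Besicovitch.card_le_of_separated (A.image fun c => (2 : ℝ) • c) ?_ ?_
    · rwa [Finset.card_image_of_injective _ hinj, finrank_euclideanSpace, Fintype.card_fin] at this
    · intro c hc
      obtain ⟨c, hcA, rfl⟩ := Finset.mem_image.1 hc
      rw [norm_smul]; norm_num
      linarith [hA.1 c hcA]
    · intro c hc d hd hcd
      obtain ⟨c, hcA, rfl⟩ := Finset.mem_image.1 hc
      obtain ⟨d, hdA, rfl⟩ := Finset.mem_image.1 hd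
      rw [← smul_sub, norm_smul]; norm_num
      linarith [hA.2 c hcA d hdA fun h => hcd (by rw [h])]
  set Q : ℕ → Prop := fun m => ∃ A, Sep A ∧ A.card = m with hQ
  have hQ0 : Q 0 := ⟨∅, by simp [hSep], rfl⟩
  -- A separated set of maximal size is a net: a point that it misses could be added to it.
  obtain ⟨A, hA, hAc⟩ := Nat.findGreatest_spec (P := Q) (Nat.zero_le (5 ^ N)) hQ0
  refine ⟨A, hcard A hA, hA.1, fun t ht => ?_⟩
  by_contra! hcon
  have htA : t ∉ A := fun h => by have := hcon t h; norm_num at this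
  have hins : Sep (insert t A) := by
    refine ⟨fun c hc => ?_, fun c hc d hd hcd => ?_⟩
    · rcases Finset.mem_insert.1 hc with rfl | hc
      exacts [ht, hA.1 c hc]
    · rcases Finset.mem_insert.1 hc with rfl | hcA <;>
        rcases Finset.mem_insert.1 hd with rfl | hdA
      · exact absurd rfl hcd
      · exact hcon d hdA
      · rw [norm_sub_rev]; exact hcon c hcA
      · exact hA.2 c hcA d hdA hcd
  have h1 := Nat.le_findGreatest (P := Q) (hcard _ hins) ⟨_, hins, rfl⟩
  rw [Finset.card_insert_of_notMem htA, hAc] at h1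
  omega

/-- Approximation by the net gives `‖f‖ ≤ √b + ‖f‖ / 2`, hence `‖f‖ ≤ 2 √b`. -/
theorem norm_sq_le_of_half_net {E F : Type*} [NormedAddCommGroup E] [NormedSpace ℝ E]
    [NormedAddCommGroup F] [NormedSpace ℝ F] {A : Finset E}
    (hA : ∀ t : E, ‖t‖ ≤ 1 → ∃ c ∈ A, ‖t - c‖ ≤ 1 / 2) (f : E →L[ℝ] F) {b : ℝ} (hb : 0 ≤ b)
    (hf : ∀ c ∈ A, ‖f c‖ ^ 2 ≤ b) (t : E) : ‖f t‖ ^ 2 ≤ 4 * b * ‖t‖ ^ 2 := by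
  have h1 : ∀ t : E, ‖t‖ = 1 → ‖f t‖ ≤ √b + ‖f‖ * (1 / 2) := by
    intro t ht
    obtain ⟨c, hc, hct⟩ := hA t ht.le
    have e1 : ‖f c‖ ≤ √b := Real.le_sqrt_of_sq_le (hf c hc)
    have e2 : ‖f (t - c)‖ ≤ ‖f‖ * (1 / 2) := (f.le_opNorm _).trans (by gcongr)
    calc ‖f t‖ = ‖f c + f (t - c)‖ := by rw [← map_add]; congr 2; abel
      _ ≤ _ := (norm_add_le _ _).trans (add_le_add e1 e2)
  have h2 : ‖f‖ ≤ √b + ‖f‖ * (1 / 2) :=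
    ContinuousLinearMap.opNorm_le_of_unit_norm (by positivity) h1
  have h3 : ‖f t‖ ≤ 2 * √b * ‖t‖ := (f.le_opNorm t).trans (by gcongr; linarith)
  calc ‖f t‖ ^ 2 ≤ (2 * √b * ‖t‖) ^ 2 := by gcongr
    _ = 4 * √b ^ 2 * ‖t‖ ^ 2 := by ring
    _ = _ := by rw [Real.sq_sqrt hb]

end Net

/-! ### Most of the weight is good. -/

section WeightedSum

/-- If every one of the events `Bad j` is unlikely, then with high probability the weights of those
that do not occur add up to half of the total weight. -/
theorem measure_tsum_indicator_lt_le {Ω J : Type*} [MeasurableSpace Ω] [Countable J]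
    (μ : Measure Ω) (Bad : J → Set Ω) {δ : ℝ≥0∞} (hB : ∀ j, μ (Bad j) ≤ δ) (t : J → ℝ≥0∞)
    (ht : ∑' j, t j ≠ ∞) :
    μ {ω | ∑' j, (Bad j)ᶜ.indicator (fun _ => t j) ω < (∑' j, t j) / 2} ≤ 2 * δ := by
  set T := ∑' j, t j with hT
  rcases eq_or_ne T 0 with h0 | h0
  · simp [h0]
  -- `D` is the bad weight, of mean at most `T * δ`. Measurable hulls are taken because the events
  -- `Bad j` need not be measurable.
  set D : Ω → ℝ≥0∞ := fun ω => ∑' j, (toMeasurable μ (Bad j)).indicator (fun _ => t j) ω with hD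
  have hDm : Measurable D := Measurable.tsum fun j =>
    measurable_const.indicator (measurableSet_toMeasurable _ _)
  have hDint : ∫⁻ ω, D ω ∂μ ≤ T * δ := by
    rw [lintegral_tsum fun j =>
      (measurable_const.indicator (measurableSet_toMeasurable _ _)).aemeasurable, hT,
      ← ENNReal.tsum_mul_right]
    refine ENNReal.tsum_le_tsum fun j => ?_
    rw [lintegral_indicator_const (measurableSet_toMeasurable _ _), measure_toMeasurable]
    gcongr; exact hB j
  have hsub : {ω | ∑' j, (Bad j)ᶜ.indicator (fun _ => t j) ω < T / 2} ⊆ {ω | T / 2 ≤ D ω} := by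
    intro ω hω
    have h1 : T ≤ ∑' j, (Bad j)ᶜ.indicator (fun _ => t j) ω + D ω := by
      rw [hD, ← ENNReal.tsum_add]
      refine ENNReal.tsum_le_tsum fun j => ?_
      by_cases hj : ω ∈ Bad j
      · simp [Set.indicator_of_mem (subset_toMeasurable μ _ hj)]
      · simp [Set.indicator_of_mem (show ω ∈ (Bad j)ᶜ from hj)]
    by_contra hcon
    have h2 := ENNReal.add_lt_add (show _ < T / 2 from hω) (not_le.1 hcon)
    rw [ENNReal.add_halves] at h2
    exact absurd h1 (not_le.2 h2)
  have h3 := (mul_meas_ge_le_lintegral₀ hDm.aemeasurable (T / 2)).trans hDint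
  have h4 : T / 2 * μ {ω | T / 2 ≤ D ω} ≤ T / 2 * (2 * δ) := by
    rw [← mul_assoc, ENNReal.div_mul_cancel two_ne_zero ENNReal.ofNat_ne_top]; exact h3
  refine (measure_mono hsub).trans ?_
  rwa [ENNReal.mul_le_mul_iff_right (by simp [h0]) (ENNReal.div_ne_top ht two_ne_zero)] at h4

end WeightedSum

/-! ### The deterministic lower bound for one direction. -/

section Deterministic

variable {J E : Type*} [NormedAddCommGroup E] [InnerProductSpace ℝ E]

/-- Lower bound on the norm of `w = A⁻¹ u j` for `A = ∑ l, u l (u l)ᵀ`: test with the component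
of `u j` orthogonal to the other leading directions. -/
theorem le_norm_sq_of_hasSum [DecidableEq J] {u : J → E} {F : Finset J} {B : ℝ} (hB : 0 ≤ B)
    (hop : ∀ T : Finset J, Disjoint T F → ∀ t, ∑ l ∈ T, ⟪u l, t⟫ ^ 2 ≤ B * ‖t‖ ^ 2) (j : J)
    {p₀ a₀ : ℝ}
    (hdist : ∀ c : {l // l ∈ F.erase j} → ℝ, p₀ ≤ ‖u j - ∑ l, c l • u l‖ ^ 2)
    (hnorm : ‖u j‖ ^ 2 ≤ a₀) {w : E}
    (hw : ∀ t, HasSum (fun l => ⟪u l, w⟫ * ⟪u l, t⟫) ⟪u j, t⟫) :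
    p₀ ≤ (a₀ + B) ^ 2 * ‖w‖ ^ 2 := by
  set W := Submodule.span ℝ (Set.range fun l : {l // l ∈ F.erase j} => u l) with hW
  have : FiniteDimensional ℝ W := FiniteDimensional.span_of_finite ℝ (Set.finite_range _)
  set t := u j - W.starProjection (u j) with ht
  have htW : t ∈ Wᗮ := W.sub_starProjection_mem_orthogonal _
  obtain ⟨c, hc⟩ := (Submodule.mem_span_range_iff_exists_fun ℝ).1
    (W.starProjection_apply_mem (u j))
  have hp : p₀ ≤ ‖t‖ ^ 2 := by rw [ht, ← hc]; exact hdist c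
  have hz : ∀ l ∈ F, l ≠ j → ⟪u l, t⟫ = 0 := fun l hl hlj =>
    Submodule.inner_right_of_mem_orthogonal
      (Submodule.subset_span (Set.mem_range.2 ⟨⟨l, Finset.mem_erase.2 ⟨hlj, hl⟩⟩, rfl⟩)) htW
  have hjt : ⟪u j, t⟫ = ‖t‖ ^ 2 := by
    have h0 : ⟪W.starProjection (u j), t⟫ = 0 :=
      Submodule.inner_right_of_mem_orthogonal (W.starProjection_apply_mem _) htW
    have : u j = t + W.starProjection (u j) := by rw [ht]; abel
    conv_lhs => rw [this]
    rw [inner_add_left, h0, add_zero, real_inner_self_eq_norm_sq]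
  have htu : ‖t‖ ≤ ‖u j‖ := by
    have h1 := real_inner_le_norm (u j) t
    rw [hjt] at h1
    by_contra! hcon
    have : 0 < ‖t‖ := (norm_nonneg _).trans_lt hcon
    nlinarith
  have hF : ∑ l ∈ F, ⟪u l, w⟫ * ⟪u l, t⟫ ≤ ‖u j‖ * ‖w‖ * ‖t‖ ^ 2 := by
    by_cases hj : j ∈ F
    · rw [Finset.sum_eq_single_of_mem j hj fun l hl hlj => by rw [hz l hl hlj, mul_zero], hjt]
      gcongr; exact real_inner_le_norm _ _
    · rw [Finset.sum_eq_zero fun l hl => by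
        rw [hz l hl fun h => hj (h ▸ hl), mul_zero]]
      positivity
  -- Among the indices in `F`, only `j` itself survives the pairing with `t`. The others are bounded
  -- by Cauchy-Schwarz and `hop`, uniformly over finite `T ⊇ F`, so the bound passes to the limit.
  have hbound : ⟪u j, t⟫ ≤ ‖u j‖ * ‖w‖ * ‖t‖ ^ 2 + B * ‖w‖ * ‖t‖ := by
    refine le_of_tendsto (hw t) ?_
    filter_upwards [Filter.eventually_ge_atTop F] with T hT
    rw [← Finset.sum_sdiff hT, add_comm]
    refine add_le_add hF ?_
    have h1 := hop (T \ F) Finset.sdiff_disjoint w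
    have h2 := hop (T \ F) Finset.sdiff_disjoint t
    have h3 := Finset.sum_mul_sq_le_sq_mul_sq (T \ F) (fun l => ⟪u l, w⟫) fun l => ⟪u l, t⟫
    refine le_of_abs_le (abs_le_of_sq_le_sq (h3.trans ?_) (by positivity))
    calc _ ≤ (B * ‖w‖ ^ 2) * (B * ‖t‖ ^ 2) :=
          mul_le_mul h1 h2 (Finset.sum_nonneg fun _ _ => sq_nonneg _) (by positivity)
      _ = _ := by ring
  rcases (norm_nonneg t).eq_or_lt with h0 | h0
  · rw [← h0] at hp
    refine hp.trans ?_
    norm_num; positivity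
  · rw [hjt] at hbound
    have h1 : ‖t‖ ≤ ‖u j‖ * ‖w‖ * ‖t‖ + B * ‖w‖ := by
      by_contra! hcon
      nlinarith
    have h2 : ‖t‖ ≤ (a₀ + B) * ‖w‖ := by
      have : ‖u j‖ * ‖t‖ ≤ a₀ := by nlinarith [norm_nonneg (u j)]
      nlinarith [norm_nonneg w]
    calc p₀ ≤ ‖t‖ ^ 2 := hp
      _ ≤ ((a₀ + B) * ‖w‖) ^ 2 := by gcongr
      _ = _ := by ring

end Deterministic

/-! ### Distances between columns and the norm of the tail. -/

namespace IndepSubgaussianArray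

variable {Ω J : Type*} [MeasurableSpace Ω] {N : ℕ}
variable {μ : Measure Ω} {U : Fin N → J → Ω → ℝ} {lam : J → ℝ} {s : ℝ}

/-- By Pythagoras the squared distance is `‖u j‖²` minus the squared projection. The first is above
`N lam j / 2` and the second below `N lam j / 4`, outside rare events. The dimension bound leaves
half of the exponent `N / (16 s²)` of the projection tail. -/
theorem measure_dist_col_lt_le [IsProbabilityMeasure μ] (h : IndepSubgaussianArray μ U lam s)
    (hs : 0 < s) {j : J} (hj : 0 < lam j) {ι : Type*} [Fintype ι]
    (g : ι → EuclideanSpace ℝ (Fin N)) (hk : (Fintype.card ι : ℝ) ≤ N / (16 * s ^ 2)) :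
    μ {ω | ∃ c : ι → ℝ, ‖arrayCol U j ω - ∑ l, c l • g l‖ ^ 2 < N / 4 * lam j} ≤
      ENNReal.ofReal (Real.exp (-(N / (512 * s ^ 4)))) +
        ENNReal.ofReal (Real.exp (-(N / (32 * s ^ 2)))) := by
  set W := Submodule.span ℝ (Set.range g) with hW
  have hfin : (Module.finrank ℝ W : ℝ) ≤ N / (16 * s ^ 2) :=
    le_trans (by exact_mod_cast finrank_range_le_card g) hk
  refine (measure_mono (t := {ω | ‖arrayCol U j ω‖ ^ 2 ≤ N / 2 * lam j} ∪
    {ω | N / 4 * lam j ≤ ‖W.starProjection (arrayCol U j ω)‖ ^ 2}) ?_).trans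
    ((measure_union_le _ _).trans (add_le_add (h.measure_norm_sq_le_le hs hj)
      ((h.measure_projection_ge_le hs hj W (N / 4)).trans (ENNReal.ofReal_le_ofReal ?_))))
  · rintro ω ⟨c, hc⟩
    rw [Set.mem_union, or_iff_not_imp_right]
    intro h1
    simp only [Set.mem_ofPred_eq, not_le] at h1 ⊢
    set y := arrayCol U j ω
    have hmem : ∑ l, c l • g l ∈ W :=
      W.sum_mem fun l _ => W.smul_mem _ (Submodule.subset_span ⟨l, rfl⟩)
    have hle : ‖y - W.starProjection y‖ ≤ ‖y - ∑ l, c l • g l‖ := by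
      rw [Submodule.starProjection_minimal]
      exact ciInf_le ⟨0, by rintro _ ⟨x, rfl⟩; exact norm_nonneg _⟩ (⟨_, hmem⟩ : W)
    have hpy : ‖y‖ ^ 2 = ‖W.starProjection y‖ ^ 2 + ‖y - W.starProjection y‖ ^ 2 := by
      have h0 : ⟪W.starProjection y, y - W.starProjection y⟫ = 0 :=
        Submodule.inner_right_of_mem_orthogonal (W.starProjection_apply_mem _)
          (W.sub_starProjection_mem_orthogonal _)
      have := norm_add_sq_eq_norm_sq_add_norm_sq_of_inner_eq_zero _ _ h0
      rw [add_sub_cancel] at this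
      nlinarith [this]
    have := pow_le_pow_left₀ (norm_nonneg _) hle 2
    linarith
  · refine Real.exp_le_exp.2 ?_
    have e1 : (N : ℝ) / 4 / (4 * s ^ 2) = N / (16 * s ^ 2) := by field_simp; norm_num
    have e2 : (N : ℝ) / (32 * s ^ 2) = N / (16 * s ^ 2) / 2 := by field_simp; ring
    rw [e1, e2]
    linarith

/-- A column is not too close to the span of few other columns. -/
theorem measure_dist_lt_le [IsProbabilityMeasure μ] (h : IndepSubgaussianArray μ U lam s)
    (hs : 0 < s) {j : J} (hj : 0 < lam j) {F : Finset J} (hF : j ∉ F)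
    (hk : (F.card : ℝ) ≤ N / (16 * s ^ 2)) :
    μ {ω | ∃ c : {l // l ∈ F} → ℝ,
        ‖arrayCol U j ω - ∑ l, c l • arrayCol U l ω‖ ^ 2 < N / 4 * lam j} ≤
      ENNReal.ofReal (Real.exp (-(N / (512 * s ^ 4)))) +
        ENNReal.ofReal (Real.exp (-(N / (32 * s ^ 2)))) := by
  set E := EuclideanSpace ℝ (Fin N)
  set X : Ω → ({l // l ∈ F} → E) := fun ω l => arrayCol U l ω with hX
  have hXm : Measurable X := measurable_pi_iff.2 fun l => h.measurable_arrayCol l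
  have hYm := h.measurable_arrayCol j
  -- Disjoint sets of columns are independent, so by Fubini the columns of `F` may be frozen and the
  -- bound for fixed vectors applied.
  have hind : IndepFun X (arrayCol U j) μ := by
    have h1 := h.indep.indepFun_finset (Finset.univ ×ˢ F) (Finset.univ ×ˢ {j})
      (by
        rw [Finset.disjoint_left]
        rintro ⟨i, l⟩ h1 h2
        simp only [Finset.mem_product, Finset.mem_univ, true_and, Finset.mem_singleton] at h1 h2
        exact hF (h2 ▸ h1)) (fun p => h.measurable _ _)
    exact h1.comp
      (φ := fun z (l : {l // l ∈ F}) => WithLp.toLp 2 fun i : Fin N =>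
        z ⟨(i, l), Finset.mem_product.2 ⟨Finset.mem_univ _, l.2⟩⟩)
      (ψ := fun z => WithLp.toLp 2 fun i : Fin N => z ⟨(i, j), by simp⟩)
      (measurable_pi_iff.2 fun l => (WithLp.measurable_toLp 2 _).comp
        (measurable_pi_iff.2 fun i => measurable_pi_apply _))
      ((WithLp.measurable_toLp 2 _).comp (measurable_pi_iff.2 fun i => measurable_pi_apply _))
  set O : Set (({l // l ∈ F} → E) × E) :=
    {p | ∃ c : {l // l ∈ F} → ℝ, ‖p.2 - ∑ l, c l • p.1 l‖ ^ 2 < N / 4 * lam j} with hO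
  have hOo : IsOpen O := by
    have : O = ⋃ c : {l // l ∈ F} → ℝ, {p | ‖p.2 - ∑ l, c l • p.1 l‖ ^ 2 < N / 4 * lam j} := by
      ext p; simp [hO]
    rw [this]
    exact isOpen_iUnion fun c => isOpen_lt (by fun_prop) continuous_const
  have hOm : MeasurableSet O := hOo.measurableSet
  have := (indepFun_iff_map_prod_eq_prod_map_map hXm.aemeasurable hYm.aemeasurable).1 hind
  have hpm : IsProbabilityMeasure (μ.map X) := Measure.isProbabilityMeasure_map hXm.aemeasurable
  calc _ = μ.map (fun ω => (X ω, arrayCol U j ω)) O := by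
        rw [Measure.map_apply (hXm.prodMk hYm) hOm]; rfl
    _ = ∫⁻ g, μ.map (arrayCol U j) (Prod.mk g ⁻¹' O) ∂μ.map X := by
        rw [this, Measure.prod_apply hOm]
    _ ≤ ∫⁻ _, (ENNReal.ofReal (Real.exp (-(N / (512 * s ^ 4)))) +
          ENNReal.ofReal (Real.exp (-(N / (32 * s ^ 2))))) ∂μ.map X := by
        refine lintegral_mono fun g => ?_
        rw [Measure.map_apply hYm (measurable_prodMk_left hOm)]
        exact h.measure_dist_col_lt_le hs hj g (by simpa using hk)
    _ = _ := by simp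

/-- For fixed `t` the numbers `⟪u l, t⟫` are independent and subgaussian with proxy at most `s² lam
l`. The Chernoff exponent `1 / (4 s² L)` turns the surplus `12 s² N L` into `3 N`, enough to pay for
a net. -/
theorem measure_sum_inner_sq_ge_le [SFinite μ] (h : IndepSubgaussianArray μ U lam s) (hs : 0 < s)
    {L S : ℝ} (hL : 0 < L) {T : Finset J} (hT : ∀ j ∈ T, lam j ≤ L) (hS : ∑ j ∈ T, lam j ≤ S)
    {t : EuclideanSpace ℝ (Fin N)} (ht : ‖t‖ ≤ 1) :
    μ {ω | 2 * s ^ 2 * S + 12 * s ^ 2 * N * L ≤ ∑ j ∈ T, ⟪arrayCol U j ω, t⟫ ^ 2} ≤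
      ENNReal.ofReal (Real.exp (-(3 * N))) := by
  have key := measure_sum_sq_ge_le μ (fun (l : {l // l ∈ T}) ω => ⟪arrayCol U l ω, t⟫)
    (fun l => (h.measurable_arrayCol l).inner_const) (fun l => s ^ 2 * lam l)
    (fun l => mul_nonneg (sq_nonneg _) (h.nonneg _)) ?_ (s := 1 / (4 * (s ^ 2 * L)))
    (by positivity) ?_ (2 * s ^ 2 * S + 12 * s ^ 2 * N * L)
  · have hatt : ∀ ω, ∑ l ∈ T.attach, ⟪arrayCol U l ω, t⟫ ^ 2 = ∑ l ∈ T, ⟪arrayCol U l ω, t⟫ ^ 2 :=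
      fun ω => Finset.sum_attach T fun l => ⟪arrayCol U l ω, t⟫ ^ 2
    simp only [Finset.univ_eq_attach, hatt, Finset.sum_attach T (fun l => s ^ 2 * lam l)] at key
    refine key.trans (ENNReal.ofReal_le_ofReal (Real.exp_le_exp.2 ?_))
    rw [← Finset.mul_sum]
    have e1 : 2 * (1 / (4 * (s ^ 2 * L))) * (s ^ 2 * ∑ j ∈ T, lam j) = (∑ j ∈ T, lam j) / (2 * L) := by
      field_simp; norm_num
    have e2 : 1 / (4 * (s ^ 2 * L)) * (2 * s ^ 2 * S + 12 * s ^ 2 * N * L) = S / (2 * L) + 3 * N := by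
      field_simp; ring
    rw [e1, e2]
    have : (∑ j ∈ T, lam j) / (2 * L) ≤ S / (2 * L) := by gcongr
    linarith
  · intro θ
    classical
    set θ' : J → ℝ := fun l => if hl : l ∈ T then θ ⟨l, hl⟩ else 0 with hθ'
    have hθ : ∀ l : {l // l ∈ T}, θ l = θ' l := fun l => by simp [hθ', l.2]
    have h1 := h.mgf_sum_le (Finset.univ ×ˢ T) fun p => t p.1 * θ' p.2
    simp only [Finset.sum_product_right] at h1
    simp_rw [hθ]
    have hatt : ∀ ω, ∑ l ∈ T.attach, θ' l * ⟪arrayCol U l ω, t⟫ =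
        ∑ l ∈ T, θ' l * ⟪arrayCol U l ω, t⟫ :=
      fun ω => Finset.sum_attach T fun l => θ' l * ⟪arrayCol U l ω, t⟫
    simp only [Finset.univ_eq_attach, hatt, Finset.sum_attach T (fun l => s ^ 2 * lam l * θ' l ^ 2)]
    simp_rw [inner_arrayCol, Finset.mul_sum]
    calc _ = _ := by
          refine lintegral_congr fun ω => ?_
          congr 2
          refine Finset.sum_congr rfl fun l _ => Finset.sum_congr rfl fun i _ => ?_
          rw [← mul_assoc, mul_comm (θ' l)]
      _ ≤ _ := h1
      _ ≤ _ := by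
          refine ENNReal.ofReal_le_ofReal (Real.exp_le_exp.2 ?_)
          rw [Finset.mul_sum]
          refine Finset.sum_le_sum fun l _ => ?_
          have e1 : ∑ i : Fin N, lam l * (t i * θ' l) ^ 2 = lam l * θ' l ^ 2 * ‖t‖ ^ 2 := by
            rw [EuclideanSpace.norm_sq_eq, Finset.mul_sum]
            refine Finset.sum_congr rfl fun i _ => ?_
            rw [Real.norm_eq_abs, sq_abs]; ring
          have e2 : ‖t‖ ^ 2 ≤ 1 := by nlinarith [norm_nonneg t]
          have e3 := h.nonneg l
          have e4 : lam l * θ' l ^ 2 * ‖t‖ ^ 2 ≤ lam l * θ' l ^ 2 * 1 := by gcongr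
          rw [e1]
          nlinarith [sq_nonneg s]
  · intro l
    have := hT l l.2
    have h2 := h.nonneg l
    rw [one_div_mul_eq_div, div_le_iff₀ (by positivity)]
    nlinarith [sq_nonneg s]

/-- Union bound over a `1/2`-net: `5 ^ N ≤ exp (2 N)` against `exp (-3 N)`. Passing from the net to
all `t` costs a factor `4`, hence `8` and `48`. -/
theorem measure_exists_sum_inner_sq_gt_le [SFinite μ] (h : IndepSubgaussianArray μ U lam s)
    (hs : 0 < s) {L S : ℝ} (hL : 0 < L) {T : Finset J} (hT : ∀ j ∈ T, lam j ≤ L)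
    (hS : ∑ j ∈ T, lam j ≤ S) :
    μ {ω | ∃ t, (8 * s ^ 2 * S + 48 * s ^ 2 * N * L) * ‖t‖ ^ 2 <
        ∑ j ∈ T, ⟪arrayCol U j ω, t⟫ ^ 2} ≤ ENNReal.ofReal (Real.exp (-N)) := by
  obtain ⟨A, hAc, hA1, hA⟩ := exists_half_net N
  have hS0 : 0 ≤ S := (Finset.sum_nonneg fun j _ => h.nonneg j).trans hS
  set b := 2 * s ^ 2 * S + 12 * s ^ 2 * N * L with hb
  have hb0 : 0 ≤ b := by positivity
  have hsub : {ω | ∃ t, (8 * s ^ 2 * S + 48 * s ^ 2 * N * L) * ‖t‖ ^ 2 <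
        ∑ j ∈ T, ⟪arrayCol U j ω, t⟫ ^ 2} ⊆
      ⋃ c ∈ A, {ω | b ≤ ∑ j ∈ T, ⟪arrayCol U j ω, c⟫ ^ 2} := by
    rintro ω ⟨t, ht⟩
    by_contra hcon
    simp only [Set.mem_iUnion, Set.mem_ofPred_eq, not_exists, not_le] at hcon
    set f : EuclideanSpace ℝ (Fin N) →L[ℝ] EuclideanSpace ℝ {l // l ∈ T} :=
      ((EuclideanSpace.equiv {l // l ∈ T} ℝ).symm :
        ({l // l ∈ T} → ℝ) →L[ℝ] EuclideanSpace ℝ {l // l ∈ T}).comp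
        (ContinuousLinearMap.pi fun l => innerSL ℝ (arrayCol U l ω)) with hf
    have hfn : ∀ y, ‖f y‖ ^ 2 = ∑ j ∈ T, ⟪arrayCol U j ω, y⟫ ^ 2 := by
      intro y
      rw [EuclideanSpace.norm_sq_eq, ← Finset.sum_attach T]
      simp [hf]
    have := norm_sq_le_of_half_net hA f hb0 (fun c hc => by rw [hfn]; exact (hcon c hc).le) t
    rw [hfn] at this
    have e : 4 * b = 8 * s ^ 2 * S + 48 * s ^ 2 * N * L := by rw [hb]; ring
    rw [e] at this
    linarith
  refine (measure_mono hsub).trans ((measure_biUnion_finset_le _ _).trans ?_)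
  calc _ ≤ ∑ _c ∈ A, ENNReal.ofReal (Real.exp (-(3 * N))) :=
        Finset.sum_le_sum fun c hc => h.measure_sum_inner_sq_ge_le hs hL hT hS (hA1 c hc)
    _ = ENNReal.ofReal (A.card * Real.exp (-(3 * N))) := by
        rw [Finset.sum_const, nsmul_eq_mul, ENNReal.ofReal_mul (by positivity)]; simp
    _ ≤ _ := by
        refine ENNReal.ofReal_le_ofReal ?_
        have e1 : (A.card : ℝ) ≤ Real.exp (2 * N) := by
          have e2 : (5 : ℝ) ≤ Real.exp 2 := by
            have := Real.quadratic_le_exp_of_nonneg (x := 2) (by norm_num)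
            linarith
          calc (A.card : ℝ) ≤ 5 ^ N := by exact_mod_cast hAc
            _ ≤ Real.exp 2 ^ N := by gcongr
            _ = _ := by rw [← Real.exp_nat_mul]; ring_nf
        calc _ ≤ Real.exp (2 * N) * Real.exp (-(3 * N)) := by gcongr
          _ = _ := by rw [← Real.exp_add]; ring_nf

/-- The columns outside `F` form an operator of small norm. -/
theorem measure_exists_finset_sum_gt_le [SFinite μ] [Countable J]
    (h : IndepSubgaussianArray μ U lam s) (hs : 0 < s) {L S : ℝ} (hL : 0 < L) {F : Finset J}
    (hT : ∀ j ∉ F, lam j ≤ L) (hS : ∀ T : Finset J, Disjoint T F → ∑ j ∈ T, lam j ≤ S) :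
    μ {ω | ∃ T : Finset J, Disjoint T F ∧ ∃ t, (8 * s ^ 2 * S + 48 * s ^ 2 * N * L) * ‖t‖ ^ 2 <
        ∑ j ∈ T, ⟪arrayCol U j ω, t⟫ ^ 2} ≤ ENNReal.ofReal (Real.exp (-N)) := by
  classical
  set V : {T : Finset J // Disjoint T F} → Set Ω := fun T =>
    {ω | ∃ t, (8 * s ^ 2 * S + 48 * s ^ 2 * N * L) * ‖t‖ ^ 2 <
        ∑ j ∈ T.1, ⟪arrayCol U j ω, t⟫ ^ 2} with hV
  -- The exceptional events grow with `T`, so continuity from below covers infinitely many columns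
  -- at no cost.
  have hmono : Monotone V := by
    rintro T T' hTT ω ⟨t, ht⟩
    exact ⟨t, ht.trans_le (Finset.sum_le_sum_of_subset_of_nonneg hTT fun _ _ _ => sq_nonneg _)⟩
  have hdir : Directed (· ⊆ ·) V := fun T T' =>
    ⟨⟨T.1 ∪ T'.1, Finset.disjoint_union_left.2 ⟨T.2, T'.2⟩⟩,
      hmono (Subtype.coe_le_coe.1 Finset.subset_union_left),
      hmono (Subtype.coe_le_coe.1 Finset.subset_union_right)⟩
  have : {ω | ∃ T : Finset J, Disjoint T F ∧ ∃ t,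
      (8 * s ^ 2 * S + 48 * s ^ 2 * N * L) * ‖t‖ ^ 2 < ∑ j ∈ T, ⟪arrayCol U j ω, t⟫ ^ 2} =
      ⋃ T, V T := by
    ext ω; simp [hV]
  rw [this, hdir.measure_iUnion]
  exact iSup_le fun T => h.measure_exists_sum_inner_sq_gt_le hs hL
    (fun j hj => hT j (Finset.disjoint_left.1 T.2 hj)) (hS _ T.2)

end IndepSubgaussianArray
-- The lower bound for an array of columns.
/-- The constant in the exponents of the deviation bounds. -/
noncomputable def rateConst (s : ℝ) : ℝ := 2 + 512 * s ^ 4 + 32 * s ^ 2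

theorem one_lt_rateConst (s : ℝ) : 1 < rateConst s := by
  have : 0 ≤ 512 * s ^ 4 + 32 * s ^ 2 := by positivity
  unfold rateConst; linarith

/-- The constant in the lower bound for one node. -/
noncomputable def riskConst (s a : ℝ) : ℝ := 1 / (4 * (62 * a * s ^ 2) ^ 2)

theorem riskConst_pos {s a : ℝ} (hs : 0 < s) (ha : 1 < a) : 0 < riskConst s a := by
  unfold riskConst; positivity

namespace IndepSubgaussianArray

variable {Ω J : Type*} [MeasurableSpace Ω] {N : ℕ}
variable {μ : Measure Ω} {U : Fin N → J → Ω → ℝ} {lam : J → ℝ} {s : ℝ}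

theorem exp_le_exp_rate {b : ℝ} (hb : 0 < b) (h : b ≤ rateConst s) (N : ℕ) :
    Real.exp (-(N / b)) ≤ Real.exp (-(N / rateConst s)) := by
  refine Real.exp_le_exp.2 (neg_le_neg ?_)
  gcongr

/-- With high probability, the vectors `w j = (∑ l, u l (u l)ᵀ)⁻¹ u j` built from the columns
`u l` satisfy `∑ j, lam j ‖w j‖² ≥ (1 / 2) ∑ j, t j`, with `t j` of order `1 / N` for `j ∈ F` and
of order `N lam j² / S²` for the other columns. -/
theorem measure_lower_bound [IsProbabilityMeasure μ] [Countable J] [DecidableEq J]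
    (h : IndepSubgaussianArray μ U lam s) (hs : 0 < s) (hN : 0 < N) {F : Finset J} {L S a : ℝ}
    (hL : 0 < L) (ha : 1 < a) (hT : ∀ j ∉ F, lam j ≤ L)
    (hS : ∀ T : Finset J, Disjoint T F → ∑ j ∈ T, lam j ≤ S)
    (hS0 : 0 < S) (hNL : N * L ≤ S) (hFL : ∀ j ∈ F, L ≤ lam j) (hFS : ∀ j ∈ F, S ≤ a * N * lam j)
    (hFc : (F.card : ℝ) ≤ N / rateConst s) (t : J → ℝ≥0∞)
    (htF : ∀ j ∈ F, t j = ENNReal.ofReal (riskConst s a / N))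
    (htn : ∀ j ∉ F, t j = ENNReal.ofReal (riskConst s a * N * lam j ^ 2 / S ^ 2))
    (htop : ∑' j, t j ≠ ∞) :
    ∃ G : Set Ω, μ Gᶜ ≤ ENNReal.ofReal (7 * Real.exp (-(N / rateConst s))) ∧
      ∀ ω ∈ G, ∀ w : J → EuclideanSpace ℝ (Fin N),
        (∀ j y, HasSum (fun l => ⟪arrayCol U l ω, w j⟫ * ⟪arrayCol U l ω, y⟫)
          ⟪arrayCol U j ω, y⟫) →
        (∑' j, t j) / 2 ≤ ∑' j, ENNReal.ofReal (lam j * ‖w j‖ ^ 2) := by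
  have hN' : (0 : ℝ) < N := by exact_mod_cast hN
  have hc0 : 0 < rateConst s := zero_lt_one.trans (one_lt_rateConst s)
  have hc1 : 1 ≤ rateConst s := (one_lt_rateConst s).le
  have hc2 : 512 * s ^ 4 ≤ rateConst s := by
    unfold rateConst; nlinarith [sq_nonneg s]
  have hc3 : 32 * s ^ 2 ≤ rateConst s := by
    unfold rateConst; nlinarith [sq_nonneg (s ^ 2)]
  have hs2 : 0 < s ^ 2 := by positivity
  set ρ := Real.exp (-(N / rateConst s)) with hρ
  have hρ0 : 0 < ρ := Real.exp_pos _
  have hr1 : Real.exp (-(N : ℝ)) ≤ ρ := by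
    have := exp_le_exp_rate one_pos hc1 N
    rwa [div_one] at this
  have hr2 : Real.exp (-(N / (512 * s ^ 4))) ≤ ρ := exp_le_exp_rate (by positivity) hc2 N
  have hr3 : Real.exp (-(N / (32 * s ^ 2))) ≤ ρ := exp_le_exp_rate (by positivity) hc3 N
  -- Columns with `lam j = 0` are never bad: their weight `t j` vanishes, so they require no
  -- estimate.
  set Bad : J → Set Ω := fun j => if 0 < lam j then
    {ω | 6 * s ^ 2 * N * lam j ≤ ‖arrayCol U j ω‖ ^ 2} ∪
    {ω | ∃ c : {l // l ∈ F.erase j} → ℝ,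
        ‖arrayCol U j ω - ∑ l, c l • arrayCol U l ω‖ ^ 2 < N / 4 * lam j} else ∅ with hBad
  have hBadm : ∀ j, μ (Bad j) ≤ ENNReal.ofReal (3 * ρ) := by
    intro j
    by_cases hj : 0 < lam j
    · simp only [hBad, if_pos hj]
      have hk : ((F.erase j).card : ℝ) ≤ N / (16 * s ^ 2) := by
        refine le_trans (by exact_mod_cast Finset.card_erase_le) (hFc.trans ?_)
        gcongr; linarith
      refine (measure_union_le _ _).trans ((add_le_add (h.measure_norm_sq_ge_le hs hj)
        (h.measure_dist_lt_le hs hj (Finset.notMem_erase j F) hk)).trans ?_)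
      rw [← ENNReal.ofReal_add (Real.exp_pos _).le (Real.exp_pos _).le,
        ← ENNReal.ofReal_add (Real.exp_pos _).le (by positivity)]
      exact ENNReal.ofReal_le_ofReal (by linarith)
    · simp [hBad, if_neg hj]
  set V := {ω | ∃ T : Finset J, Disjoint T F ∧ ∃ t,
    (8 * s ^ 2 * S + 48 * s ^ 2 * N * L) * ‖t‖ ^ 2 < ∑ j ∈ T, ⟪arrayCol U j ω, t⟫ ^ 2} with hV
  have hVm : μ V ≤ ENNReal.ofReal (Real.exp (-N)) :=
    h.measure_exists_finset_sum_gt_le hs hL hT hS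
  set Z := {ω | ∑' j, (Bad j)ᶜ.indicator (fun _ => t j) ω < (∑' j, t j) / 2} with hZ
  have hZm := measure_tsum_indicator_lt_le μ Bad hBadm t htop
  refine ⟨(V ∪ Z)ᶜ, ?_, fun ω hω w hw => ?_⟩
  · rw [compl_compl]
    refine (measure_union_le _ _).trans ((add_le_add hVm hZm).trans ?_)
    -- The failure probability is `ρ` for the tail norm and `2 * 3ρ` for the weights, whence `7`.
    rw [show (2 : ℝ≥0∞) = ENNReal.ofReal 2 by simp, ← ENNReal.ofReal_mul (by norm_num),
      ← ENNReal.ofReal_add (Real.exp_pos _).le (by positivity)]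
    exact ENNReal.ofReal_le_ofReal (by linarith)
  · have hωV : ω ∉ V := fun h' => hω (Or.inl h')
    have hωZ : (∑' j, t j) / 2 ≤ ∑' j, (Bad j)ᶜ.indicator (fun _ => t j) ω :=
      not_lt.1 fun h' => hω (Or.inr h')
    refine hωZ.trans (ENNReal.tsum_le_tsum fun j => ?_)
    by_cases hjb : ω ∈ Bad j
    · simp [Set.indicator_of_notMem (show ω ∉ (Bad j)ᶜ from fun h' => h' hjb)]
    rw [Set.indicator_of_mem (show ω ∈ (Bad j)ᶜ from hjb)]
    by_cases hj : 0 < lam j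
    · simp only [hBad, if_pos hj, Set.mem_union, Set.mem_ofPred_eq, not_or, not_le, not_exists,
        not_lt] at hjb
      have hop : ∀ T : Finset J, Disjoint T F → ∀ y,
          ∑ l ∈ T, ⟪arrayCol U l ω, y⟫ ^ 2 ≤ (8 * s ^ 2 * S + 48 * s ^ 2 * N * L) * ‖y‖ ^ 2 := by
        intro T hTF y
        by_contra! hcon
        exact hωV ⟨T, hTF, y, hcon⟩
      have key := le_norm_sq_of_hasSum (by positivity) hop j hjb.2 hjb.1.le (hw j)
      -- It remains to bound the denominator by `D = 62 a s² N lam j` on `F` and by `D = 62 a s² S`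
      -- off `F`, where `62 = 6 + 8 + 48`.
      have hmain : ∀ D, 0 < D → 6 * s ^ 2 * N * lam j + (8 * s ^ 2 * S + 48 * s ^ 2 * N * L) ≤ D →
          N * lam j ^ 2 / (4 * D ^ 2) ≤ lam j * ‖w j‖ ^ 2 := by
        intro D hD hle
        have h1 : N / 4 * lam j ≤ D ^ 2 * ‖w j‖ ^ 2 := key.trans (by gcongr)
        rw [div_le_iff₀ (by positivity)]
        nlinarith
      by_cases hjF : j ∈ F
      · rw [htF j hjF]
        refine ENNReal.ofReal_le_ofReal (le_trans (le_of_eq ?_)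
          (hmain (62 * a * s ^ 2 * (N * lam j)) (by positivity) ?_))
        · unfold riskConst; field_simp
        · have e1 := hFS j hjF
          have e2 : N * L ≤ a * N * lam j := by
            have := hFL j hjF
            calc N * L ≤ 1 * N * lam j := by rw [one_mul]; gcongr
              _ ≤ _ := by gcongr
          have e3 : N * lam j ≤ a * N * lam j := by
            rw [mul_assoc]; exact le_mul_of_one_le_left (by positivity) ha.le
          have e4 : 6 * (N * lam j) + (8 * S + 48 * (N * L)) ≤ 62 * (a * N * lam j) := by linarith
          nlinarith [mul_le_mul_of_nonneg_left e4 hs2.le]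
      · rw [htn j hjF]
        refine ENNReal.ofReal_le_ofReal (le_trans (le_of_eq ?_)
          (hmain (62 * a * s ^ 2 * S) (by positivity) ?_))
        · unfold riskConst; field_simp
        · have e1 : N * lam j ≤ S := le_trans (by gcongr; exact hT j hjF) hNL
          have e3 : S ≤ a * S := le_mul_of_one_le_left hS0.le ha.le
          have e4 : 6 * (N * lam j) + (8 * S + 48 * (N * L)) ≤ 62 * (a * S) := by linarith
          nlinarith [mul_le_mul_of_nonneg_left e4 hs2.le]
    · have hj0 : lam j = 0 := le_antisymm (not_lt.1 hj) (h.nonneg j)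
      have hjF : j ∉ F := fun hjF => by
        have := hFL j hjF; linarith
      rw [htn j hjF, hj0]; simp

end IndepSubgaussianArray
-- The noise contribution to the conditional risk.
section Noise

variable {X : Type*} [MeasurableSpace X]

/-- Disintegrate over the input and expand the square: the cross term has mean zero and the last one
is at least `σ² g²`. Lower integrals are used since `b` and `g` are merely measurable. -/
theorem lintegral_sq_add_le (P : Measure (X × ℝ)) [IsProbabilityMeasure P] {σ : ℝ} (hσ : 0 < σ)
    (hint : Integrable (fun p : X × ℝ => p.2) P)
    (hcen : P[fun p : X × ℝ => p.2 | MeasurableSpace.comap Prod.fst inferInstance] =ᵐ[P] 0)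
    (hvar : (fun _ => σ ^ 2) ≤ᵐ[P]
      P[fun p : X × ℝ => p.2 ^ 2 | MeasurableSpace.comap Prod.fst inferInstance])
    {b g : X → ℝ} (hb : Measurable b) (hg : Measurable g) :
    ∫⁻ p, ENNReal.ofReal (b p.1 ^ 2 + σ ^ 2 * g p.1 ^ 2) ∂P ≤
      ∫⁻ p, ENNReal.ofReal ((b p.1 + p.2 * g p.1) ^ 2) ∂P := by
  have hint2 : Integrable (fun p : X × ℝ => p.2 ^ 2) P := by
    -- Without integrability the conditional expectation is `0` by convention, which contradicts the
    -- bound `σ² > 0`.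
    by_contra hcon
    rw [condExp_of_not_integrable hcon] at hvar
    obtain ⟨p, hp⟩ := hvar.exists
    have : 0 < σ ^ 2 := by positivity
    exact absurd hp (not_le.2 this)
  have hmap : P.map (fun p : X × ℝ => (p.1, p.2)) = P := by simp
  set κ := condDistrib (Prod.snd : X × ℝ → ℝ) Prod.fst P with hκ
  have hPκ : (P.map Prod.fst) ⊗ₘ κ = P :=
    (compProd_map_condDistrib measurable_snd.aemeasurable).trans hmap
  have h1 := condExp_ae_eq_integral_condDistrib (μ := P) (X := (Prod.fst : X × ℝ → X))
    (Y := (Prod.snd : X × ℝ → ℝ)) measurable_fst measurable_snd.aemeasurable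
    (f := fun e => e) stronglyMeasurable_id hint
  have h2 := condExp_ae_eq_integral_condDistrib (μ := P) (X := (Prod.fst : X × ℝ → X))
    (Y := (Prod.snd : X × ℝ → ℝ)) measurable_fst measurable_snd.aemeasurable
    (f := fun e => e ^ 2) (by fun_prop) hint2
  have i1 := Integrable.condDistrib_ae (μ := P) (X := (Prod.fst : X × ℝ → X))
    (Y := (Prod.snd : X × ℝ → ℝ)) (f := fun p => p.2) measurable_fst.aemeasurable
    measurable_snd.aemeasurable (by rwa [hmap])
  have i2 := Integrable.condDistrib_ae (μ := P) (X := (Prod.fst : X × ℝ → X))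
    (Y := (Prod.snd : X × ℝ → ℝ)) (f := fun p => p.2 ^ 2) measurable_fst.aemeasurable
    measurable_snd.aemeasurable (by rwa [hmap])
  have hF : Measurable fun p : X × ℝ => ENNReal.ofReal ((b p.1 + p.2 * g p.1) ^ 2) := by fun_prop
  have hrhs : ∫⁻ p, ENNReal.ofReal ((b p.1 + p.2 * g p.1) ^ 2) ∂P =
      ∫⁻ p, ∫⁻ e, ENNReal.ofReal ((b p.1 + e * g p.1) ^ 2) ∂κ p.1 ∂P := by
    conv_lhs => rw [← hPκ]
    rw [Measure.lintegral_compProd hF,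
      lintegral_map (hF.lintegral_kernel_prod_right') measurable_fst]
  rw [hrhs]
  refine lintegral_mono_ae ?_
  filter_upwards [h1, h2, i1, i2, hcen, hvar] with p h1 h2 i1 i2 hc hv
  rw [hc] at h1
  rw [h2] at hv
  have hexp : ∀ e : ℝ, (b p.1 + e * g p.1) ^ 2 =
      b p.1 ^ 2 + 2 * b p.1 * g p.1 * e + g p.1 ^ 2 * e ^ 2 := fun e => by ring
  have hI : Integrable (fun e : ℝ => b p.1 ^ 2 + 2 * b p.1 * g p.1 * e + g p.1 ^ 2 * e ^ 2)
      (κ p.1) := ((integrable_const _).add (i1.const_mul _)).add (i2.const_mul _)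
  simp_rw [hexp]
  rw [← ofReal_integral_eq_lintegral_ofReal hI (ae_of_all _ fun e => by
    simp only [Pi.zero_apply]; rw [← hexp]; positivity)]
  refine ENNReal.ofReal_le_ofReal ?_
  have e1 : ∫ e, (b p.1 ^ 2 + 2 * b p.1 * g p.1 * e + g p.1 ^ 2 * e ^ 2) ∂κ p.1 =
      ∫ e, (b p.1 ^ 2 + 2 * b p.1 * g p.1 * e) ∂κ p.1 + ∫ e, g p.1 ^ 2 * e ^ 2 ∂κ p.1 :=
    integral_add (f := fun e => b p.1 ^ 2 + 2 * b p.1 * g p.1 * e)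
      ((integrable_const _).add (i1.const_mul _)) (i2.const_mul _)
  have e2 : ∫ e, (b p.1 ^ 2 + 2 * b p.1 * g p.1 * e) ∂κ p.1 =
      ∫ _, b p.1 ^ 2 ∂κ p.1 + ∫ e, 2 * b p.1 * g p.1 * e ∂κ p.1 :=
    integral_add (integrable_const _) (i1.const_mul _)
  have e3 : ∫ e, e ∂κ p.1 = 0 := h1.symm
  rw [e1, e2, integral_const_mul, integral_const_mul, e3]
  simp only [integral_const, probReal_univ, smul_eq_mul, one_mul, mul_zero, add_zero]
  have : σ ^ 2 ≤ ∫ e, e ^ 2 ∂κ p.1 := hv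
  nlinarith [mul_le_mul_of_nonneg_right this (sq_nonneg (g p.1))]

/-- Independent centered noise with variance at least `σ²` does not cancel. -/
theorem lintegral_sum_sq_le (P : Measure (X × ℝ)) [IsProbabilityMeasure P] {σ : ℝ} (hσ : 0 < σ)
    (hint : Integrable (fun p : X × ℝ => p.2) P)
    (hcen : P[fun p : X × ℝ => p.2 | MeasurableSpace.comap Prod.fst inferInstance] =ᵐ[P] 0)
    (hvar : (fun _ => σ ^ 2) ≤ᵐ[P]
      P[fun p : X × ℝ => p.2 ^ 2 | MeasurableSpace.comap Prod.fst inferInstance])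
    {ι : Type*} [Fintype ι] {b : (ι → X) → ℝ} {g : ι → (ι → X) → ℝ} (hb : Measurable b)
    (hg : ∀ i, Measurable (g i)) :
    ∫⁻ z, ENNReal.ofReal (σ ^ 2 * ∑ i, g i (fun l => (z l).1) ^ 2) ∂Measure.pi (fun _ : ι => P) ≤
      ∫⁻ z, ENNReal.ofReal ((b (fun l => (z l).1) + ∑ i, (z i).2 * g i (fun l => (z l).1)) ^ 2)
        ∂Measure.pi (fun _ : ι => P) := by
  classical
  -- Interpolation: noise in `s` is kept, noise outside `s` is replaced by its variance bound.
  -- Adding one index changes the integral over a single pair `(x i, ε i)`, while the other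
  -- coordinates stay fixed.
  set Φ : Finset ι → (ι → X × ℝ) → ℝ≥0∞ := fun s z =>
    ENNReal.ofReal ((b (fun l => (z l).1) + ∑ i ∈ s, (z i).2 * g i (fun l => (z l).1)) ^ 2) +
      ENNReal.ofReal (σ ^ 2 * ∑ i ∈ sᶜ, g i (fun l => (z l).1) ^ 2) with hΦ
  have hΦm : ∀ s, Measurable (Φ s) := fun s => by
    have hx : Measurable fun (z : ι → X × ℝ) (l : ι) => (z l).1 := by fun_prop
    have := hb.comp hx
    have hgx : ∀ i, Measurable fun z : ι → X × ℝ => g i fun l => (z l).1 := fun i => (hg i).comp hx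
    simp only [hΦ]
    refine Measurable.add (Measurable.ennreal_ofReal ((this.add
      (Finset.measurable_fun_sum _ fun i _ => Measurable.mul (by fun_prop) (hgx i))).pow_const 2))
      (Measurable.ennreal_ofReal (measurable_const.mul
        (Finset.measurable_fun_sum _ fun i _ => (hgx i).pow_const 2)))
  have hstep : ∀ s, ∫⁻ z, Φ ∅ z ∂Measure.pi (fun _ : ι => P) ≤
      ∫⁻ z, Φ s z ∂Measure.pi (fun _ : ι => P) := by
    intro s
    induction s using Finset.induction_on with
    | empty => exact le_rfl
    | insert i s hi ih =>
      refine ih.trans (lintegral_le_of_lmarginal_le {i} (hΦm _) (hΦm _) fun z => ?_)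
      simp only [lmarginal_singleton]
      have hupd : ∀ p : X × ℝ, (fun l => (Function.update z i p l).1) =
          Function.update (fun l => (z l).1) i p.1 := by
        intro p; ext l
        by_cases hl : l = i
        · subst hl; simp
        · simp [hl]
      set y : X → ι → X := fun a => Function.update (fun l => (z l).1) i a with hy
      have hym : Measurable y := measurable_update _
      have hs : ∀ p : X × ℝ, ∑ l ∈ s, (Function.update z i p l).2 * g l (y p.1) =
          ∑ l ∈ s, (z l).2 * g l (y p.1) := fun p => Finset.sum_congr rfl fun l hl => by
        rw [Function.update_of_ne (ne_of_mem_of_not_mem hl hi)]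
      set b' : X → ℝ := fun a => b (y a) + ∑ l ∈ s, (z l).2 * g l (y a) with hb'
      have hgm : ∀ l, Measurable fun a => g l (y a) := fun l => (hg l).comp hym
      have hb'm : Measurable b' := (hb.comp hym).add
        (Finset.measurable_fun_sum _ fun l _ => measurable_const.mul (hgm l))
      set R : X → ℝ := fun a => σ ^ 2 * ∑ l ∈ (insert i s)ᶜ, g l (y a) ^ 2 with hR
      have hRm : Measurable R := measurable_const.mul
        (Finset.measurable_fun_sum _ fun l _ => (hgm l).pow_const 2)
      have e1 : ∀ p : X × ℝ, Φ s (Function.update z i p) =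
          ENNReal.ofReal (b' p.1 ^ 2 + σ ^ 2 * g i (y p.1) ^ 2) + ENNReal.ofReal (R p.1) := by
        intro p
        have hc : sᶜ = insert i (insert i s)ᶜ := by ext l; by_cases l = i <;> simp_all
        have hR0 : 0 ≤ R p.1 :=
          mul_nonneg (sq_nonneg _) (Finset.sum_nonneg fun _ _ => sq_nonneg _)
        simp only [hΦ, hupd]
        rw [hs p, hc, Finset.sum_insert (by simp), mul_add,
          ENNReal.ofReal_add (by positivity) hR0, ENNReal.ofReal_add (by positivity) (by positivity),
          add_assoc]
      have e2 : ∀ p : X × ℝ, Φ (insert i s) (Function.update z i p) =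
          ENNReal.ofReal ((b' p.1 + p.2 * g i (y p.1)) ^ 2) + ENNReal.ofReal (R p.1) := by
        intro p
        simp only [hΦ, hupd]
        rw [Finset.sum_insert hi, hs p, Function.update_self]
        congr 3
        simp only [hb']; ring
      simp_rw [e1, e2]
      have hRm' : Measurable fun p : X × ℝ => ENNReal.ofReal (R p.1) :=
        (hRm.comp measurable_fst).ennreal_ofReal
      rw [lintegral_add_right _ hRm', lintegral_add_right _ hRm']
      refine add_le_add_left ?_ _
      exact lintegral_sq_add_le P hσ hint hcen hvar hb'm (hgm i)
  have h1 := hstep Finset.univ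
  simp only [hΦ, Finset.sum_empty, Finset.compl_empty, Finset.compl_univ, mul_zero,
    ENNReal.ofReal_zero, add_zero] at h1
  exact le_trans (lintegral_mono fun z => le_add_self) h1

/-- Conditionally on the inputs, the quadratic risk of an estimator that is affine in the noise is
at least the contribution of the noise. -/
theorem tsum_le_condLExp (P : Measure (X × ℝ)) [IsProbabilityMeasure P] {σ : ℝ} (hσ : 0 < σ)
    (hint : Integrable (fun p : X × ℝ => p.2) P)
    (hcen : P[fun p : X × ℝ => p.2 | MeasurableSpace.comap Prod.fst inferInstance] =ᵐ[P] 0)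
    (hvar : (fun _ => σ ^ 2) ≤ᵐ[P]
      P[fun p : X × ℝ => p.2 ^ 2 | MeasurableSpace.comap Prod.fst inferInstance])
    {Ω ι J : Type*} [Fintype ι] [Countable J] [MeasurableSpace Ω] (μ : Measure Ω)
    [IsProbabilityMeasure μ] {x : ι → Ω → X} {ε : ι → Ω → ℝ} (hx : ∀ i, Measurable (x i))
    (hε : ∀ i, Measurable (ε i)) (hlaw : ∀ i, μ.map (fun ω => (x i ω, ε i ω)) = P)
    (hind : iIndepFun (fun i ω => (x i ω, ε i ω)) μ) {lam : J → ℝ} (hlam : ∀ j, 0 ≤ lam j)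
    {b : J → (ι → X) → ℝ} {g : J → ι → (ι → X) → ℝ} (hb : ∀ j, Measurable (b j))
    (hg : ∀ j i, Measurable (g j i)) {f : Ω → ℝ≥0∞}
    (hf : f =ᵐ[μ] fun ω => ∑' j, ENNReal.ofReal
      (lam j * (b j (fun l => x l ω) + ∑ i, ε i ω * g j i (fun l => x l ω)) ^ 2)) :
    (fun ω => ∑' j, ENNReal.ofReal (lam j * (σ ^ 2 * ∑ i, g j i (fun l => x l ω) ^ 2))) ≤ᵐ[μ]
      condLExp (MeasurableSpace.comap (fun ω i => x i ω) MeasurableSpace.pi) μ f := by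
  set xs : Ω → ι → X := fun ω i => x i ω with hxs
  have hxsm : Measurable xs := measurable_pi_iff.2 hx
  have hm : MeasurableSpace.comap xs MeasurableSpace.pi ≤ ‹MeasurableSpace Ω› := hxsm.comap_le
  set Z : Ω → ι → X × ℝ := fun ω i => (x i ω, ε i ω) with hZ
  have hZm : Measurable Z := measurable_pi_iff.2 fun i => (hx i).prodMk (hε i)
  have hZlaw : μ.map Z = Measure.pi fun _ : ι => P := by
    rw [hZ, (iIndepFun_iff_map_fun_eq_pi_map fun i => ((hx i).prodMk (hε i)).aemeasurable).1 hind]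
    congr 1; ext1 i; exact hlaw i
  have hfst : Measurable fun (z : ι → X × ℝ) (l : ι) => (z l).1 := by fun_prop
  have hterm : ∀ j, Measurable fun y : ι → X =>
      ENNReal.ofReal (lam j * (σ ^ 2 * ∑ i, g j i y ^ 2)) := fun j =>
    (measurable_const.mul (measurable_const.mul
      (Finset.measurable_fun_sum _ fun i _ => (hg j i).pow_const 2))).ennreal_ofReal
  have hL : Measurable fun y : ι → X =>
      ∑' j, ENNReal.ofReal (lam j * (σ ^ 2 * ∑ i, g j i y ^ 2)) := Measurable.tsum hterm
  refine ae_le_of_ae_le_trim (hm := hm) ?_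
  -- It suffices to compare integrals over the events `xs ⁻¹' B`. The indicator of `B` is a function
  -- of the inputs, so it is absorbed into `b` and `g`, and the unconditional inequality applies.
  refine ae_le_of_forall_setLIntegral_le_of_sigmaFinite
    (hL.comp (comap_measurable xs)) fun s hs _ => ?_
  rw [setLIntegral_condLExp_trim hm μ f hs]
  refine (setLIntegral_trim hm (hL.comp (comap_measurable xs)) hs).trans_le ?_
  obtain ⟨B, hB, rfl⟩ := hs
  have hsm : MeasurableSet (xs ⁻¹' B) := hxsm hB
  rw [setLIntegral_congr_fun_ae hsm (hf.mono fun _ h _ => h)]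
  have hR : ∀ j, Measurable fun ω => ENNReal.ofReal
      (lam j * (b j (xs ω) + ∑ i, ε i ω * g j i (xs ω)) ^ 2) := fun j =>
    (measurable_const.mul ((((hb j).comp hxsm).add (Finset.measurable_fun_sum _ fun i _ =>
      (hε i).mul ((hg j i).comp hxsm))).pow_const 2)).ennreal_ofReal
  have hterm' : ∀ j, Measurable fun ω =>
      ENNReal.ofReal (lam j * (σ ^ 2 * ∑ i, g j i (xs ω) ^ 2)) := fun j => (hterm j).comp hxsm
  simp only [Function.comp_apply]
  rw [lintegral_tsum fun j => (hR j).aemeasurable,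
    lintegral_tsum fun j => (hterm' j).aemeasurable]
  refine ENNReal.tsum_le_tsum fun j => ?_
  simp_rw [ENNReal.ofReal_mul (hlam j)]
  rw [lintegral_const_mul' _ _ ENNReal.ofReal_ne_top, lintegral_const_mul' _ _ ENNReal.ofReal_ne_top]
  refine mul_le_mul' le_rfl ?_
  set b' : (ι → X) → ℝ := B.indicator (b j) with hb'
  set g' : ι → (ι → X) → ℝ := fun i => B.indicator (g j i) with hg'
  have hb'm : Measurable b' := (hb j).indicator hB
  have hg'm : ∀ i, Measurable (g' i) := fun i => (hg j i).indicator hB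
  have key := lintegral_sum_sq_le P hσ hint hcen hvar hb'm hg'm
  rw [← hZlaw, lintegral_map _ hZm, lintegral_map _ hZm] at key
  · rw [← lintegral_indicator hsm, ← lintegral_indicator hsm]
    refine le_trans (le_of_eq (lintegral_congr fun ω => ?_))
      (key.trans (le_of_eq (lintegral_congr fun ω => ?_)))
    · by_cases hω : xs ω ∈ B
      · rw [Set.indicator_of_mem (show ω ∈ xs ⁻¹' B from hω)]
        simp only [hg', hZ]
        simp only [Set.indicator_of_mem (show (fun l => x l ω) ∈ B from hω)]
        rfl
      · rw [Set.indicator_of_notMem (show ω ∉ xs ⁻¹' B from hω)]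
        simp only [hg', hZ]
        simp [Set.indicator_of_notMem (show (fun l => x l ω) ∉ B from hω)]
    · by_cases hω : xs ω ∈ B
      · rw [Set.indicator_of_mem (show ω ∈ xs ⁻¹' B from hω)]
        simp only [hg', hb', hZ]
        simp only [Set.indicator_of_mem (show (fun l => x l ω) ∈ B from hω)]
        rfl
      · rw [Set.indicator_of_notMem (show ω ∉ xs ⁻¹' B from hω)]
        simp only [hg', hb', hZ]
        simp [Set.indicator_of_notMem (show (fun l => x l ω) ∉ B from hω)]
  · exact (((hb'm.comp hfst).add (Finset.measurable_fun_sum _ fun i _ =>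
      Measurable.mul (by fun_prop) ((hg'm i).comp hfst))).pow_const 2).ennreal_ofReal
  · exact (measurable_const.mul (Finset.measurable_fun_sum _ fun i _ =>
      ((hg'm i).comp hfst).pow_const 2)).ennreal_ofReal

end Noise
-- Closed form of the estimator through the Gram matrix `X Xᵀ`.
section LinearAlgebra

variable {H : Type*} [NormedAddCommGroup H] [InnerProductSpace ℝ H]

theorem dataMatrix_apply {N : ℕ} (x : Fin N → H) (b : H) (i : Fin N) :
    dataMatrix x b i = ⟪x i, b⟫ := by
  simp [dataMatrix]

theorem inner_sum_smul {N : ℕ} (x : Fin N → H) (c : Fin N → ℝ) (i : Fin N) :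
    ⟪x i, ∑ l, c l • x l⟫ = (Matrix.gram ℝ x).mulVec c i := by
  rw [inner_sum, Matrix.mulVec, dotProduct]
  refine Finset.sum_congr rfl fun l _ => ?_
  rw [inner_smul_right, Matrix.gram_apply, mul_comm]

theorem gram_mulVec_inv {N : ℕ} {x : Fin N → H} (hx : LinearIndependent ℝ x) (y : Fin N → ℝ) :
    (Matrix.gram ℝ x).mulVec ((Matrix.gram ℝ x)⁻¹.mulVec y) = y := by
  rw [Matrix.mulVec_mulVec, Matrix.mul_nonsing_inv _
    (Matrix.det_gram_ne_zero_iff_linearIndependent.2 hx).isUnit, Matrix.one_mulVec]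

/-- For independent inputs the candidate interpolates, so every minimizer does. Their difference is
orthogonal to all inputs, hence to the candidate, and Pythagoras gives minimality. -/
theorem minNormEstimator_eq [CompleteSpace H] {N : ℕ} {x : Fin N → H}
    (hx : LinearIndependent ℝ x) (y : Fin N → ℝ) :
    minNormEstimator x (WithLp.toLp 2 y) = ∑ i, (Matrix.gram ℝ x)⁻¹.mulVec y i • x i := by
  set c := (Matrix.gram ℝ x)⁻¹.mulVec y with hc
  refine (existsUnique_isMinNorm x (WithLp.toLp 2 y)).unique
    (existsUnique_isMinNorm x (WithLp.toLp 2 y)).choose_spec.1 ?_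
  have h0 : dataMatrix x (∑ i, c i • x i) - WithLp.toLp 2 y = 0 := by
    ext i
    rw [PiLp.sub_apply, dataMatrix_apply, inner_sum_smul, hc, gram_mulVec_inv hx]
    simp
  refine ⟨fun β' => by rw [h0, norm_zero, zero_pow two_ne_zero]; exact sq_nonneg _, fun β' hβ' => ?_⟩
  have h1 := hβ' (∑ i, c i • x i)
  rw [h0, norm_zero, zero_pow two_ne_zero] at h1
  have h2 : dataMatrix x β' - WithLp.toLp 2 y = 0 :=
    norm_eq_zero.1 (pow_eq_zero_iff two_ne_zero |>.1 (le_antisymm h1 (sq_nonneg _)))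
  have h3 : ∀ i, ⟪x i, β' - ∑ i, c i • x i⟫ = 0 := fun i => by
    have e1 := congrArg (fun z : EuclideanSpace ℝ (Fin N) => z i) (h2.trans h0.symm)
    simp only [PiLp.sub_apply, dataMatrix_apply] at e1
    rw [inner_sub_right]; linarith
  have h4 : ⟪∑ i, c i • x i, β' - ∑ i, c i • x i⟫ = 0 := by
    rw [sum_inner]
    exact Finset.sum_eq_zero fun i _ => by rw [inner_smul_left, h3, mul_zero]
  have := norm_add_sq_eq_norm_sq_add_norm_sq_of_inner_eq_zero _ _ h4
  rw [add_sub_cancel] at this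
  nlinarith [sq_nonneg ‖β' - ∑ i, c i • x i‖]

theorem gram_inv_mulVec_dotProduct {N : ℕ} (x : Fin N → H) (y z : Fin N → ℝ) :
    (Matrix.gram ℝ x)⁻¹.mulVec y ⬝ᵥ z = y ⬝ᵥ (Matrix.gram ℝ x)⁻¹.mulVec z := by
  have hs : ((Matrix.gram ℝ x)⁻¹).transpose = (Matrix.gram ℝ x)⁻¹ := by
    rw [Matrix.transpose_nonsing_inv]
    congr 1
    ext i j
    rw [Matrix.transpose_apply, Matrix.gram_apply, Matrix.gram_apply, real_inner_comm]
  rw [Matrix.dotProduct_mulVec, ← Matrix.mulVec_transpose, hs]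

/-- The coordinate of the averaged estimator along `u` is affine in the responses. -/
theorem inner_averagedEstimator [CompleteSpace H] {n M N : ℕ} (e : Fin M × Fin N ≃ Fin n)
    {x : Fin n → H} (hx : ∀ m, LinearIndependent ℝ fun i => x (e (m, i))) (y : Fin n → ℝ) (u : H) :
    ⟪u, averagedEstimator e x y⟫ = ∑ l, y l * ((M : ℝ)⁻¹ *
      (Matrix.gram ℝ fun i => x (e ((e.symm l).1, i)))⁻¹.mulVec
        (fun i => ⟪u, x (e ((e.symm l).1, i))⟫) (e.symm l).2) := by
  rw [averagedEstimator, inner_smul_right, inner_sum, ← e.sum_comp, Fintype.sum_prod_type,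
    Finset.mul_sum]
  refine Finset.sum_congr rfl fun m _ => ?_
  rw [minNormEstimator_eq (hx m), inner_sum]
  have := gram_inv_mulVec_dotProduct (fun i => x (e (m, i))) (fun i => y (e (m, i)))
    fun i => ⟪u, x (e (m, i))⟫
  simp only [dotProduct] at this
  simp_rw [inner_smul_right, this, Finset.mul_sum, Equiv.symm_apply_apply]
  exact Finset.sum_congr rfl fun i _ => by ring

/-- The weak form of `(∑ l, u l (u l)ᵀ) w = X u`. It is Parseval's identity in the basis `v` for `Xᵀ
w` and `Xᵀ y`, because the Gram matrix sends the coefficients of `w` to `X u`. -/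
theorem hasSum_inner_col {J : Type*} (v : HilbertBasis J ℝ H) {N : ℕ} {x : Fin N → H}
    (hx : LinearIndependent ℝ x) (u : H) (y : EuclideanSpace ℝ (Fin N)) :
    HasSum (fun l => ⟪(WithLp.toLp 2 fun i => ⟪v l, x i⟫ : EuclideanSpace ℝ (Fin N)),
        WithLp.toLp 2 ((Matrix.gram ℝ x)⁻¹.mulVec fun i => ⟪u, x i⟫)⟫ *
      ⟪(WithLp.toLp 2 fun i => ⟪v l, x i⟫ : EuclideanSpace ℝ (Fin N)), y⟫)
      ⟪(WithLp.toLp 2 fun i => ⟪u, x i⟫ : EuclideanSpace ℝ (Fin N)), y⟫ := by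
  set c := (Matrix.gram ℝ x)⁻¹.mulVec fun i => ⟪u, x i⟫ with hc
  have h := v.hasSum_inner_mul_inner (∑ i, c i • x i) (∑ i, y i • x i)
  have e1 : ∀ (l : J) (z : EuclideanSpace ℝ (Fin N)),
      ⟪(WithLp.toLp 2 fun i => ⟪v l, x i⟫ : EuclideanSpace ℝ (Fin N)), z⟫ =
        ⟪v l, ∑ i, z i • x i⟫ := by
    intro l z
    simp [PiLp.inner_apply, inner_sum, inner_smul_right]
  have e2 : ⟪(WithLp.toLp 2 fun i => ⟪u, x i⟫ : EuclideanSpace ℝ (Fin N)), y⟫ =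
      ⟪∑ i, c i • x i, ∑ i, y i • x i⟫ := by
    rw [inner_sum, PiLp.inner_apply]
    refine Finset.sum_congr rfl fun i _ => ?_
    rw [inner_smul_right, real_inner_comm (x i) (∑ l, c l • x l), inner_sum_smul, hc, gram_mulVec_inv hx]
    simp
  rw [e2]
  refine h.congr_fun fun l => ?_
  rw [e1, e1, real_inner_comm]

theorem linearIndependent_of_starProjection {ι : Type*} {x : ι → H} (K : Submodule ℝ H)
    [K.HasOrthogonalProjection] (h : LinearIndependent ℝ fun i => K.starProjection (x i)) :
    LinearIndependent ℝ x :=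
  LinearIndependent.of_comp (K.starProjection : H →ₗ[ℝ] H) h

theorem ofReal_norm_covSqrt_sq {d : ℕ∞} (v : HilbertBasis {j : ℕ // (j : ℕ∞) < d} ℝ H)
    {lam : ℕ → ℝ} (h0 : ∀ j, 0 ≤ lam j) (ha : Antitone lam) (u : H) :
    ENNReal.ofReal (‖covSqrt v lam u‖ ^ 2) =
      ∑' j : {j : ℕ // (j : ℕ∞) < d}, ENNReal.ofReal (lam j * ⟪v j, u⟫ ^ 2) := by
  have hsq : ∀ j : {j : ℕ // (j : ℕ∞) < d},
      ‖√(lam j) * ⟪v j, u⟫‖ ^ (2 : ℝ≥0∞).toReal = lam j * ⟪v j, u⟫ ^ 2 := fun j => by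
    rw [ENNReal.toReal_ofNat, Real.rpow_two, Real.norm_eq_abs, sq_abs, mul_pow,
      Real.sq_sqrt (h0 _)]
  have hsum : Summable fun j : {j : ℕ // (j : ℕ∞) < d} => lam j * ⟪v j, u⟫ ^ 2 := by
    have h1 := (v.summable_inner_mul_inner u u).mul_left (lam 0)
    refine Summable.of_nonneg_of_le (fun j => mul_nonneg (h0 _) (sq_nonneg _)) (fun j => ?_) h1
    rw [real_inner_comm, sq]
    exact mul_le_mul_of_nonneg_right (ha (Nat.zero_le _)) (mul_self_nonneg _)
  have hmem : Memℓp (fun j : {j : ℕ // (j : ℕ∞) < d} => √(lam j) * ⟪v j, u⟫) 2 :=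
    memℓp_gen (by simpa only [hsq] using hsum)
  set f : lp (fun _ : {j : ℕ // (j : ℕ∞) < d} => ℝ) 2 := ⟨_, hmem⟩ with hf
  have hcov : covSqrt v lam u = v.repr.symm f := (v.hasSum_repr_symm f).tsum_eq
  have hn := lp.norm_rpow_eq_tsum (p := 2) (by norm_num) f
  have hn' : ‖f‖ ^ 2 = ∑' j : {j : ℕ // (j : ℕ∞) < d}, lam j * ⟪v j, u⟫ ^ 2 := by
    have : ‖f‖ ^ (2 : ℝ≥0∞).toReal = ‖f‖ ^ 2 := by simp
    rw [← this, hn]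
    exact tsum_congr hsq
  rw [hcov, LinearIsometryEquiv.norm_map, hn',
    ENNReal.ofReal_tsum_of_nonneg (fun j => mul_nonneg (h0 _) (sq_nonneg _)) hsum]

end LinearAlgebra

/-! ### From the design assumptions to an independent subgaussian array. -/

section DesignFacts

variable {H : Type*} [NormedAddCommGroup H] [InnerProductSpace ℝ H] [MeasurableSpace H]
variable {P : Measure (H × ℝ)} {d : ℕ∞} {v : HilbertBasis {j : ℕ // (j : ℕ∞) < d} ℝ H}
  {lam : ℕ → ℝ} {σx τ : ℝ}

namespace DesignAssumption

theorem integrable_inner_smul (h : DesignAssumption P d v lam σx τ) (u : H) :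
    Integrable (fun p : H × ℝ => ⟪u, p.1⟫ • p.1) P := by
  have h2 := (memLp_two_iff_integrable_sq_norm h.input_sq_integrable.1).1 h.input_sq_integrable
  have hm : AEStronglyMeasurable (fun p : H × ℝ => ⟪u, p.1⟫ • p.1) P :=
    (aestronglyMeasurable_const.inner h.input_sq_integrable.1).smul h.input_sq_integrable.1
  refine (h2.const_mul ‖u‖).mono' hm (ae_of_all _ fun p => ?_)
  rw [norm_smul, sq, ← mul_assoc]
  gcongr
  exact norm_inner_le_norm _ _

theorem lintegral_exp_le (h : DesignAssumption P d v lam σx τ) (j : {j : ℕ // (j : ℕ∞) < d})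
    (θ : ℝ) : ∫⁻ p, ENNReal.ofReal (Real.exp (θ * ⟪v j, p.1⟫)) ∂P ≤
      ENNReal.ofReal (Real.exp (σx ^ 2 / 2 * (lam j * θ ^ 2))) := by
  obtain ⟨h1, h2⟩ := h.input_subgaussian (θ • v j)
  have hcov : covOp P (θ • v j) = θ • lam j • v j := by
    rw [← h.eigenvector j, covOp, covOp, ← integral_smul]
    simp only [inner_smul_left, mul_smul]; rfl
  rw [h.input_centered] at h1 h2
  simp only [sub_zero, inner_smul_left, hcov, conj_trivial] at h1 h2
  rw [← ofReal_integral_eq_lintegral_ofReal h1 (ae_of_all _ fun p => (Real.exp_pos _).le)]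
  refine ENNReal.ofReal_le_ofReal (h2.trans (le_of_eq ?_))
  rw [inner_smul_right, real_inner_self_eq_norm_sq, v.orthonormal.1 j]
  congr 1; ring

variable [CompleteSpace H]

theorem integral_inner_sq (h : DesignAssumption P d v lam σx τ) (j : {j : ℕ // (j : ℕ∞) < d}) :
    ∫ p, ⟪v j, p.1⟫ ^ 2 ∂P = lam j := by
  have h1 := h.eigenvector j
  have h2 : ⟪v j, covOp P (v j)⟫ = ∫ p, ⟪v j, ⟪v j, p.1⟫ • p.1⟫ ∂P :=
    (integral_inner (h.integrable_inner_smul (v j)) (v j)).symm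
  rw [h1, inner_smul_right, real_inner_self_eq_norm_sq, v.orthonormal.1 j] at h2
  simp only [inner_smul_right] at h2
  simp only [sq]
  rw [← h2]; ring

theorem lam_nonneg (h : DesignAssumption P d v lam σx τ) (j : ℕ) : 0 ≤ lam j := by
  by_cases hj : (j : ℕ∞) < d
  · rw [← h.integral_inner_sq ⟨j, hj⟩]
    exact integral_nonneg fun p => sq_nonneg _
  · exact (h.eigenvalue_zero j (not_lt.1 hj)).ge

theorem lintegral_inner_sq (h : DesignAssumption P d v lam σx τ)
    (j : {j : ℕ // (j : ℕ∞) < d}) :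
    ∫⁻ p, ENNReal.ofReal (⟪v j, p.1⟫ ^ 2) ∂P = ENNReal.ofReal (lam j) := by
  rw [← h.integral_inner_sq j, ofReal_integral_eq_lintegral_ofReal _ (ae_of_all _ fun p => sq_nonneg _)]
  have := (h.integrable_inner_smul (v j)).const_inner (𝕜 := ℝ) (v j)
  simpa only [inner_smul_right, ← sq] using this

/-- The coordinates of an i.i.d. sample in the eigenbasis. -/
theorem indepSubgaussianArray [BorelSpace H] [TopologicalSpace.SeparableSpace H]
    [IsProbabilityMeasure P] (h : DesignAssumption P d v lam σx τ)
    {Ω : Type*} [MeasurableSpace Ω] {μ : Measure Ω} [IsProbabilityMeasure μ] {N : ℕ}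
    {x : Fin N → Ω → H} (hx : ∀ i, Measurable (x i)) (hlaw : ∀ i, μ.map (x i) = P.map Prod.fst)
    (hind : iIndepFun x μ) :
    IndepSubgaussianArray μ (fun i (j : {j : ℕ // (j : ℕ∞) < d}) ω => ⟪v j, x i ω⟫)
      (fun j => lam j) σx := by
  have hcm : ∀ j, Measurable fun z : H => ⟪v j, z⟫ := fun j =>
    (continuous_const.inner continuous_id).measurable
  have hcm' : Measurable fun (z : H) (j : {j : ℕ // (j : ℕ∞) < d}) => ⟪v j, z⟫ :=
    measurable_pi_iff.2 hcm
  have hxm : ∀ i j, Measurable fun ω => ⟪v j, x i ω⟫ := fun i j => (hcm j).comp (hx i)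
  have htr : ∀ i (φ : H → ℝ≥0∞), Measurable φ → ∫⁻ ω, φ (x i ω) ∂μ = ∫⁻ p, φ p.1 ∂P := by
    intro i φ hφ
    rw [← lintegral_map hφ (hx i), hlaw i, lintegral_map hφ measurable_fst]
  refine ⟨hxm, ?_, fun j => h.lam_nonneg j, fun i j θ => ?_, fun i j => ?_⟩
  · refine iIndepFun_uncurry' (X := fun i j ω => ⟪v j, x i ω⟫) hxm
      (hind.comp (fun _ z j => ⟪v j, z⟫) fun _ => hcm') fun i => ?_
    have hP := (iIndepFun_iff_map_fun_eq_infinitePi_map (P := P)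
      (X := fun j (p : H × ℝ) => ⟪v j, p.1⟫) fun j => (hcm j).comp measurable_fst).1 h.input_indep
    rw [iIndepFun_iff_map_fun_eq_infinitePi_map (hxm i)]
    have e1 : μ.map (fun ω j => ⟪v j, x i ω⟫) = P.map fun p j => ⟪v j, p.1⟫ := by
      have a1 := Measure.map_map (μ := μ) hcm' (hx i)
      have a2 := Measure.map_map (μ := P) hcm' measurable_fst
      rw [hlaw i] at a1
      exact a1.symm.trans a2
    have e2 : ∀ j, μ.map (fun ω => ⟪v j, x i ω⟫) = P.map fun p => ⟪v j, p.1⟫ := fun j => by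
      have a1 := Measure.map_map (μ := μ) (hcm j) (hx i)
      have a2 := Measure.map_map (μ := P) (hcm j) measurable_fst
      rw [hlaw i] at a1
      exact a1.symm.trans a2
    rw [e1, hP]
    congr 1
    ext1 j
    exact (e2 j).symm
  · rw [htr i (fun z => ENNReal.ofReal (Real.exp (θ * ⟪v j, z⟫)))
      ((hcm j).const_mul θ).exp.ennreal_ofReal]
    exact h.lintegral_exp_le j θ
  · rw [htr i (fun z => ENNReal.ofReal (⟪v j, z⟫ ^ 2)) ((hcm j).pow_const 2).ennreal_ofReal]
    exact h.lintegral_inner_sq j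

end DesignAssumption

end DesignFacts

/-! ### Effective dimension and the sum of the weights. -/

section EffectiveDimension

theorem effDim_spec {lam : ℕ → ℝ} {a N : ℝ} {k : ℕ} (h : effDim lam a N = k) :
    (0 < lam k ∧ a * N ≤ effRank lam k) ∧ ∀ l < k, ¬(0 < lam l ∧ a * N ≤ effRank lam l) := by
  have hmin : ∀ l < k, ¬(0 < lam l ∧ a * N ≤ effRank lam l) := by
    intro l hl hcon
    have h1 : effDim lam a N ≤ l := iInf₂_le l hcon
    rw [h] at h1
    exact absurd (by exact_mod_cast h1) (not_le.2 hl)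
  refine ⟨?_, hmin⟩
  by_contra hk
  -- A finite infimum in `ℕ∞` is attained: otherwise `k + 1` would also be a lower bound.
  have h1 : ((k + 1 : ℕ) : ℕ∞) ≤ effDim lam a N := by
    refine le_iInf₂ fun l hl => ?_
    by_contra! hcon
    have h2 : l < k + 1 := by exact_mod_cast hcon
    rcases Nat.lt_succ_iff_lt_or_eq.1 h2 with h3 | rfl
    exacts [hmin l h3 hl, hk hl]
  rw [h] at h1
  have : k + 1 ≤ k := by exact_mod_cast h1
  omega

variable {lam : ℕ → ℝ}

/-- A divergent `tsum` is `0` by convention, so a positive rank forces summability. -/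
theorem summable_of_effRank_pos {k : ℕ} (h : 0 < effRank lam k) : Summable lam := by
  have h1 : Summable fun j => lam (k + j) := by
    by_contra hcon
    rw [effRank, tsum_eq_zero_of_not_summable hcon, zero_div] at h
    exact lt_irrefl _ h
  rw [← summable_nat_add_iff k]
  simpa only [add_comm] using h1

theorem sum_le_tsum_shift (h0 : ∀ j, 0 ≤ lam j) (hs : Summable lam) {k : ℕ} (T : Finset ℕ)
    (hT : ∀ j ∈ T, k ≤ j) : ∑ j ∈ T, lam j ≤ ∑' j, lam (k + j) := by
  have hinj : Set.InjOn (fun j => j - k) (T : Set ℕ) := fun i hi j hj hij => by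
    have := hT i hi; have := hT j hj
    simp only at hij; omega
  have h1 : ∑ j ∈ T, lam j = ∑ i ∈ T.image (fun j => j - k), lam (k + i) := by
    rw [Finset.sum_image hinj]
    refine Finset.sum_congr rfl fun j hj => ?_
    rw [Nat.add_sub_cancel' (hT j hj)]
  rw [h1]
  refine Summable.sum_le_tsum _ (fun i _ => h0 _) ?_
  simpa only [add_comm] using (summable_nat_add_iff k).2 hs

theorem tsum_shift_le (h0 : ∀ j, 0 ≤ lam j) (hs : Summable lam) {l k : ℕ} (hlk : l ≤ k) :
    ∑' j, lam (k + j) ≤ ∑' j, lam (l + j) := by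
  have h1 : ∀ m, Summable fun j => lam (m + j) := fun m => by
    simpa only [add_comm] using (summable_nat_add_iff m).2 hs
  refine Summable.tsum_le_of_sum_le (h1 k) fun T => ?_
  have := sum_le_tsum_shift h0 hs (k := l) (T.image fun j => k + j) fun j hj => by
    obtain ⟨i, -, rfl⟩ := Finset.mem_image.1 hj
    omega
  rwa [Finset.sum_image fun i _ j _ hij => by simpa using hij] at this

/-- The total weight of the lower bounds, `k / N + N / R_k` up to a constant. -/
theorem tsum_weights {d : ℕ∞} (hd : ∀ j : ℕ, d ≤ j → lam j = 0) {k N : ℕ} (hk : (k : ℕ∞) ≤ d)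
    (h0 : ∀ j, 0 ≤ lam j) (ha : Antitone lam) (hs : Summable lam) {κ : ℝ} (hκ : 0 ≤ κ) :
    ∑' j : {j : ℕ // (j : ℕ∞) < d}, (if (j : ℕ) < k then ENNReal.ofReal (κ / N) else
      ENNReal.ofReal (κ * N * lam j ^ 2 / (∑' i, lam (k + i)) ^ 2)) =
    ENNReal.ofReal (κ * (k / N + N * (1 / effRankSq lam k))) := by
  set S := ∑' i, lam (k + i) with hS
  set t : ℕ → ℝ≥0∞ := fun j => if j < k then ENNReal.ofReal (κ / N) else
      ENNReal.ofReal (κ * N * lam j ^ 2 / S ^ 2) with ht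
  -- Indices beyond the dimension are at least `k` and have `lam j = 0`, so the sum may be taken
  -- over all of `ℕ`.
  have hsub : ∑' j : {j : ℕ // (j : ℕ∞) < d}, t j = ∑' j, t j := by
    refine tsum_subtype_eq_of_support_subset (s := {j : ℕ | (j : ℕ∞) < d}) fun j hj => ?_
    by_contra hcon
    have hdj : d ≤ j := not_lt.1 hcon
    have hkj : ¬ j < k := fun h => by
      have : (j : ℕ∞) < k := by exact_mod_cast h
      exact absurd (hk.trans hdj) (not_le.2 this)
    refine hj ?_
    simp [ht, hkj, hd j hdj]
  have hs1 : Summable fun i => lam (k + i) := by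
    simpa only [add_comm] using (summable_nat_add_iff k).2 hs
  have hs2 : Summable fun i => lam (k + i) ^ 2 := by
    refine Summable.of_nonneg_of_le (fun i => sq_nonneg _) (fun i => ?_) (hs1.mul_left (lam 0))
    rw [sq]
    exact mul_le_mul_of_nonneg_right (ha (Nat.zero_le _)) (h0 _)
  have e1 : ∑ j ∈ Finset.range k, t j = ENNReal.ofReal (κ * (k / N)) := by
    rw [Finset.sum_congr rfl (g := fun _ => ENNReal.ofReal (κ / N)) fun j hj => by
      simp [ht, Finset.mem_range.1 hj], Finset.sum_const, Finset.card_range, nsmul_eq_mul,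
      ← ENNReal.ofReal_natCast, ← ENNReal.ofReal_mul (by positivity)]
    congr 1; ring
  have e2 : ∑' i, t (i + k) = ENNReal.ofReal (κ * (N * (1 / effRankSq lam k))) := by
    have : ∀ i, t (i + k) = ENNReal.ofReal (κ * N / S ^ 2 * lam (k + i) ^ 2) := fun i => by
      have : ¬ i + k < k := by omega
      simp only [ht, if_neg this]
      rw [add_comm i k]; congr 1; ring
    simp_rw [this]
    rw [← ENNReal.ofReal_tsum_of_nonneg (fun i => by positivity) (hs2.mul_left _), tsum_mul_left,
      effRankSq, one_div_div]
    congr 1; ring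
  have hR : 0 ≤ 1 / effRankSq lam k := by
    rw [effRankSq, one_div_div]
    exact div_nonneg (tsum_nonneg fun i => sq_nonneg _) (sq_nonneg _)
  change ∑' j : {j : ℕ // (j : ℕ∞) < d}, t j = _
  rw [hsub, ← ENNReal.summable.sum_add_tsum_nat_add' (k := k), e1, e2,
    ← ENNReal.ofReal_add (by positivity) (by positivity), ← mul_add]

end EffectiveDimension

/-! ### One node, the averaged risk, and all nodes together. -/

section Main

variable {H : Type*} [NormedAddCommGroup H] [InnerProductSpace ℝ H]
  [MeasurableSpace H] [BorelSpace H] [TopologicalSpace.SeparableSpace H]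
variable {P : Measure (H × ℝ)} {d : ℕ∞} {v : HilbertBasis {j : ℕ // (j : ℕ∞) < d} ℝ H}
  {lam : ℕ → ℝ} {σx τ : ℝ}

/-- The vector `(X Xᵀ)⁻¹ X u` for the inputs `x`. -/
noncomputable def dualVec {N : ℕ} (x : Fin N → H) (u : H) : EuclideanSpace ℝ (Fin N) :=
  WithLp.toLp 2 ((Matrix.gram ℝ x)⁻¹.mulVec fun i => ⟪u, x i⟫)

/-- The inverse matrix is the inverted determinant times the adjugate; both are continuous before
the inversion, which is measurable even where the determinant vanishes. -/
theorem measurable_dualVec {N : ℕ} (u : H) (i : Fin N) :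
    Measurable fun x : Fin N → H => dualVec x u i := by
  have : SecondCountableTopology H := UniformSpace.secondCountable_of_separable H
  have hgram : Continuous fun x : Fin N → H => Matrix.gram ℝ x :=
    continuous_matrix fun i l => by simp only [Matrix.gram_apply]; fun_prop
  have hinv : ∀ i l, Measurable fun x : Fin N → H => (Matrix.gram ℝ x)⁻¹ i l := fun i l => by
    simp only [Matrix.inv_def, Matrix.smul_apply, Ring.inverse_eq_inv', smul_eq_mul]
    exact hgram.matrix_det.measurable.inv.mul (hgram.matrix_adjugate.matrix_elem i l).measurable
  simp only [dualVec, Matrix.mulVec, dotProduct]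
  exact Finset.measurable_fun_sum _ fun l _ => (hinv i l).mul (by fun_prop)

variable [CompleteSpace H]

theorem node_lower_bound [IsProbabilityMeasure P] (h : DesignAssumption P d v lam σx τ)
    (hσx : 0 < σx) {Ω : Type*} [MeasurableSpace Ω] {μ : Measure Ω} [IsProbabilityMeasure μ]
    {N : ℕ} (hN : 0 < N) {x : Fin N → Ω → H} (hx : ∀ i, Measurable (x i))
    (hlaw : ∀ i, μ.map (x i) = P.map Prod.fst) (hind : iIndepFun x μ) {a : ℝ} (ha : 1 < a) {k : ℕ}
    (hk : effDim lam a N = k) (hkN : (k : ℝ) ≤ N / rateConst σx) :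
    ∃ G : Set Ω, μ Gᶜ ≤ ENNReal.ofReal (7 * Real.exp (-(N / rateConst σx))) ∧
      ∀ ω ∈ G, LinearIndependent ℝ (fun i => x i ω) →
        ENNReal.ofReal (riskConst σx a / 2 * (k / N + N * (1 / effRankSq lam k))) ≤
          ∑' j : {j : ℕ // (j : ℕ∞) < d},
            ENNReal.ofReal (lam j * ‖dualVec (fun i => x i ω) (v j)‖ ^ 2) := by
  classical
  have hN' : (0 : ℝ) < N := by exact_mod_cast hN
  obtain ⟨⟨hLk, hrk⟩, hmin⟩ := effDim_spec hk
  have hd : ∀ j, 0 < lam j → (j : ℕ∞) < d := fun j hj => by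
    by_contra hcon
    exact hj.ne' (h.eigenvalue_zero j (not_lt.1 hcon))
  have hkd := hd k hLk
  have h0 := h.lam_nonneg
  have hanti := h.eigenvalue_antitone
  have haN : 0 < a * N := by positivity
  have hs : Summable lam := summable_of_effRank_pos (haN.trans_le hrk)
  set S := ∑' i, lam (k + i) with hSdef
  have hS : a * N * lam k ≤ S := by
    rwa [effRank, le_div_iff₀ hLk] at hrk
  have hS0 : 0 < S := (mul_pos haN hLk).trans_le hS
  set emb : Fin k ↪ {j : ℕ // (j : ℕ∞) < d} :=
    ⟨fun i => ⟨i, lt_trans (by exact_mod_cast i.2) hkd⟩, fun i l hil => by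
      simpa [Fin.ext_iff] using hil⟩ with hemb
  set F : Finset {j : ℕ // (j : ℕ∞) < d} := Finset.univ.map emb with hF
  have hmem : ∀ j, j ∈ F ↔ (j : ℕ) < k := by
    intro j
    rw [hF, Finset.mem_map]
    constructor
    · rintro ⟨i, -, rfl⟩; exact i.2
    · intro hj; exact ⟨⟨j, hj⟩, Finset.mem_univ _, rfl⟩
  have hcard : F.card = k := by simp [hF]
  have harr := h.indepSubgaussianArray hx hlaw hind
  have hw := tsum_weights (N := N) h.eigenvalue_zero hkd.le h0 hanti hs (riskConst_pos hσx ha).le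
  obtain ⟨G, hG, hGw⟩ := harr.measure_lower_bound hσx hN (F := F) (L := lam k) (S := S) hLk ha
    (fun j hj => hanti (not_lt.1 fun hlt => hj ((hmem j).2 hlt)))
    (fun T hT => by
      have := sum_le_tsum_shift h0 hs (k := k) (T.map (Function.Embedding.subtype _))
        fun j hj => by
          obtain ⟨i, hi, rfl⟩ := Finset.mem_map.1 hj
          exact not_lt.1 fun hlt => Finset.disjoint_left.1 hT hi ((hmem i).2 hlt)
      rwa [Finset.sum_map] at this)
    hS0
    (le_trans (mul_le_mul_of_nonneg_right (le_mul_of_one_le_left hN'.le ha.le) hLk.le) hS)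
    (fun j hj => hanti ((hmem j).1 hj).le)
    -- Minimality of `k`: for `j < k` the sum of the eigenvalues from `j` on is below `a N lam j`,
    -- and it dominates `S`.
    (fun j hj => by
      have hj' := (hmem j).1 hj
      have hpos : 0 < lam j := hLk.trans_le (hanti hj'.le)
      have h1 := not_and.1 (hmin j hj') hpos
      rw [not_le, effRank, div_lt_iff₀ hpos] at h1
      exact (tsum_shift_le h0 hs hj'.le).trans h1.le)
    (by rwa [hcard])
    (fun j => if (j : ℕ) < k then ENNReal.ofReal (riskConst σx a / N) else
      ENNReal.ofReal (riskConst σx a * N * lam j ^ 2 / S ^ 2))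
    (fun j hj => if_pos ((hmem j).1 hj))
    (fun j hj => if_neg fun hlt => hj ((hmem j).2 hlt))
    (by rw [hw]; exact ENNReal.ofReal_ne_top)
  refine ⟨G, hG, fun ω hω hli => ?_⟩
  refine le_trans (le_of_eq ?_) (hGw ω hω (fun j => dualVec (fun i => x i ω) (v j))
    fun j y => hasSum_inner_col v hli (v j) y)
  rw [hw, ← ENNReal.ofReal_ofNat 2, ← ENNReal.ofReal_div_of_pos two_pos]
  congr 1; ring

/-- Each coordinate of the error is a function of the inputs plus `∑ l, ε l * g j l`. The nodes use
disjoint samples, so their noise variances add, and the averaging factor `1 / M` enters squared. -/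
theorem noise_risk_le_condExcessRisk [IsProbabilityMeasure P] (h : DesignAssumption P d v lam σx τ)
    {σ : ℝ} (hσ : 0 < σ) (hvar : NoiseLowerBound P σ) {Ω : Type*} [MeasurableSpace Ω]
    {μ : Measure Ω} [IsProbabilityMeasure μ] {n M N : ℕ} (e : Fin M × Fin N ≃ Fin n)
    {x : Fin n → Ω → H} {ε : Fin n → Ω → ℝ} (βstar : H) (hx : ∀ i, Measurable (x i))
    (hε : ∀ i, Measurable (ε i)) (hlaw : ∀ i, μ.map (fun ω => (x i ω, ε i ω)) = P)
    (hind : iIndepFun (fun i ω => (x i ω, ε i ω)) μ)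
    (hli : ∀ᵐ ω ∂μ, ∀ m, LinearIndependent ℝ fun i => x (e (m, i)) ω) :
    (fun ω => ∑ m, ENNReal.ofReal (σ ^ 2 / M ^ 2) * ∑' j : {j : ℕ // (j : ℕ∞) < d},
      ENNReal.ofReal (lam j * ‖dualVec (fun i => x (e (m, i)) ω) (v j)‖ ^ 2)) ≤ᵐ[μ]
      condExcessRisk μ v lam e x ε βstar := by
  have h0 := h.lam_nonneg
  set g : {j : ℕ // (j : ℕ∞) < d} → Fin n → (Fin n → H) → ℝ := fun j l y =>
    (M : ℝ)⁻¹ * dualVec (fun i => y (e ((e.symm l).1, i))) (v j) (e.symm l).2 with hg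
  set b : {j : ℕ // (j : ℕ∞) < d} → (Fin n → H) → ℝ := fun j y =>
    ∑ l, ⟪βstar, y l⟫ * g j l y - ⟪v j, βstar⟫ with hb
  have hgm : ∀ j l, Measurable (g j l) := fun j l =>
    measurable_const.mul ((measurable_dualVec (v j) (e.symm l).2).comp
      (measurable_pi_iff.2 fun i => measurable_pi_apply _))
  have hbm : ∀ j, Measurable (b j) := fun j => (Finset.measurable_fun_sum _ fun l _ =>
    Measurable.mul (by fun_prop) (hgm j l)).sub_const _
  have key := tsum_le_condLExp P hσ h.noise_integrable h.noise_centered hvar μ hx hε hlaw hind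
    (fun j : {j : ℕ // (j : ℕ∞) < d} => h0 j) hbm hgm
    (f := fun ω => ENNReal.ofReal (‖covSqrt v lam (averagedEstimator e (fun i => x i ω)
      (fun i => ⟪βstar, x i ω⟫ + ε i ω) - βstar)‖ ^ 2)) ?_
  · filter_upwards [key] with ω hω
    refine le_trans (le_of_eq ?_) hω
    simp_rw [← ENNReal.tsum_mul_left]
    rw [← Summable.tsum_finsetSum fun _ _ => ENNReal.summable]
    refine tsum_congr fun j => ?_
    have hgs : ∑ l, g j l (fun l => x l ω) ^ 2 =
        ∑ m, (1 / M ^ 2) * ‖dualVec (fun i => x (e (m, i)) ω) (v j)‖ ^ 2 := by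
      rw [← e.sum_comp, Fintype.sum_prod_type]
      refine Finset.sum_congr rfl fun m _ => ?_
      rw [EuclideanSpace.norm_sq_eq, Finset.mul_sum]
      refine Finset.sum_congr rfl fun i _ => ?_
      simp only [hg, Equiv.symm_apply_apply, Real.norm_eq_abs, sq_abs]
      rw [mul_pow, inv_pow, one_div]
    rw [hgs, Finset.mul_sum, Finset.mul_sum, ENNReal.ofReal_sum_of_nonneg fun m _ =>
      mul_nonneg (h0 _) (by positivity)]
    refine Finset.sum_congr rfl fun m _ => ?_
    rw [← ENNReal.ofReal_mul (by positivity)]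
    congr 1; ring
  · filter_upwards [hli] with ω hω
    rw [ofReal_norm_covSqrt_sq v h0 h.eigenvalue_antitone]
    refine tsum_congr fun j => ?_
    rw [inner_sub_right, inner_averagedEstimator e hω]
    congr 3
    simp only [hb, hg, dualVec, add_mul, Finset.sum_add_distrib]
    ring

theorem measureReal_condExcessRisk_ge [IsProbabilityMeasure P]
    (hD : DesignAssumption P d v lam σx τ) (hσx : 0 < σx) {σ : ℝ} (hσ : 0 < σ)
    (hV : NoiseLowerBound P σ) {Ω : Type*} [MeasurableSpace Ω] {μ : Measure Ω}
    [IsProbabilityMeasure μ] {n M N : ℕ} (hM : 0 < M) (hN : 0 < N) (e : Fin M × Fin N ≃ Fin n)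
    {x : Fin n → Ω → H} {ε : Fin n → Ω → ℝ} (βstar : H) (hx : ∀ i, Measurable (x i))
    (hε : ∀ i, Measurable (ε i)) (hlaw : ∀ i, μ.map (fun ω => (x i ω, ε i ω)) = P)
    (hind : iIndepFun (fun i ω => (x i ω, ε i ω)) μ) (hGP : GeneralPosition μ v e x)
    {a : ℝ} (ha : 1 < a) {k : ℕ} (hk : effDim lam a N = k) (hkN : (k : ℝ) ≤ N / rateConst σx) :
    1 - 10 * M * Real.exp (-(1 / rateConst σx) * N) ≤
      μ.real {ω | ENNReal.ofReal (riskConst σx a / 2 * σ ^ 2 *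
          ((k : ℝ) / n + (n : ℝ) / M ^ 2 * (1 / effRankSq lam k)))
        ≤ condExcessRisk μ v lam e x ε βstar ω} := by
  have hn : n = M * N := by simpa using (Fintype.card_congr e).symm
  have hM' : (0 : ℝ) < M := by exact_mod_cast hM
  have hN' : (0 : ℝ) < N := by exact_mod_cast hN
  have hnR : (n : ℝ) = M * N := by exact_mod_cast hn
  -- Since `lam k > 0`, the basis vector `v k` exists, and general position with respect to its
  -- hyperplane makes the inputs of each node independent.
  have hkd : (k : ℕ∞) < d := by
    by_contra hcon
    exact (effDim_spec hk).1.1.ne' (hD.eigenvalue_zero k (not_lt.1 hcon))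
  have hli : ∀ᵐ ω ∂μ, ∀ m, LinearIndependent ℝ fun i => x (e (m, i)) ω := by
    rw [ae_all_iff]
    intro m
    filter_upwards [hGP m] with ω hω
    exact linearIndependent_of_starProjection (x := fun i => x (e (m, i)) ω)
      (ℝ ∙ (v ⟨k, hkd⟩ : H))ᗮ (hω ⟨k, hkd⟩)
  have hxlaw : ∀ i, μ.map (x i) = P.map Prod.fst := fun i => by
    rw [← hlaw i, Measure.map_map measurable_fst ((hx i).prodMk (hε i))]; rfl
  have hxind : iIndepFun x μ := hind.comp (fun _ => Prod.fst) fun _ => measurable_fst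
  have hnode := fun m : Fin M => node_lower_bound hD hσx hN (x := fun i => x (e (m, i)))
    (fun i => hx _) (fun i => hxlaw _)
    (hxind.precomp (g := fun i => e (m, i)) fun i l hil =>
      (Prod.mk.inj (e.injective hil)).2) ha hk hkN
  choose G hG hGw using hnode
  have hrisk := noise_risk_le_condExcessRisk hD hσ hV e βstar hx hε hlaw hind hli
  set A := {ω | ENNReal.ofReal (riskConst σx a / 2 * σ ^ 2 *
    ((k : ℝ) / n + (n : ℝ) / M ^ 2 * (1 / effRankSq lam k))) ≤
      condExcessRisk μ v lam e x ε βstar ω} with hA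
  set ρ := Real.exp (-(1 / rateConst σx) * N) with hρ
  have hρ' : Real.exp (-(N / rateConst σx)) = ρ := by rw [hρ]; congr 1; ring
  have hsub : Aᶜ ≤ᵐ[μ] ⋃ m, (G m)ᶜ := by
    filter_upwards [hli, hrisk] with ω h1 h2
    intro hωA
    change ω ∈ ⋃ m, (G m)ᶜ
    by_contra hcon
    simp only [Set.mem_iUnion, Set.mem_compl_iff, not_exists, not_not] at hcon
    refine hωA (le_trans ?_ h2)
    calc ENNReal.ofReal (riskConst σx a / 2 * σ ^ 2 *
          ((k : ℝ) / n + (n : ℝ) / M ^ 2 * (1 / effRankSq lam k)))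
        = ∑ _m : Fin M, ENNReal.ofReal (σ ^ 2 / M ^ 2) *
            ENNReal.ofReal (riskConst σx a / 2 * (k / N + N * (1 / effRankSq lam k))) := by
          -- With `n = M N`, `M` equal terms of size `1 / M²` turn `k / N` into `k / n` and `N` into
          -- `n / M²`.
          rw [Finset.sum_const, Finset.card_univ, Fintype.card_fin, nsmul_eq_mul,
            ← ENNReal.ofReal_natCast, ← ENNReal.ofReal_mul (by positivity),
            ← ENNReal.ofReal_mul (by positivity), hnR]
          congr 1
          field_simp
      _ ≤ _ := Finset.sum_le_sum fun m _ => mul_le_mul' le_rfl (hGw m ω (hcon m) (h1 m))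
  have hAc : μ Aᶜ ≤ ENNReal.ofReal (7 * M * ρ) := by
    refine (measure_mono_ae hsub).trans ((measure_iUnion_fintype_le _ _).trans
      ((Finset.sum_le_sum fun m _ => hG m).trans (le_of_eq ?_)))
    rw [Finset.sum_const, Finset.card_univ, Fintype.card_fin, nsmul_eq_mul,
      ← ENNReal.ofReal_natCast, ← ENNReal.ofReal_mul (by positivity), hρ']
    congr 1; ring
  -- Subadditivity is enough here; measurability of `A` is not needed.
  have h1 : (1 : ℝ) ≤ μ.real A + μ.real Aᶜ := by
    have := measureReal_union_le (μ := μ) A Aᶜ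
    rwa [Set.union_compl_self, probReal_univ] at this
  have h2 : μ.real Aᶜ ≤ 7 * M * ρ := ENNReal.toReal_le_of_le_ofReal (by positivity) hAc
  have h3 : 0 < M * ρ := by positivity
  linarith

end Main

end DistRidgeless

open DistRidgeless
theorem theorem2 (σx : ℝ) (hσx : 0 < σx) :
    ∃ c : ℝ, 1 < c ∧ ∀ a : ℝ, 1 < a → ∃ ca : ℝ, 0 < ca ∧
      ∀ (H : Type*) [NormedAddCommGroup H] [InnerProductSpace ℝ H] [CompleteSpace H]
        [TopologicalSpace.SeparableSpace H] [MeasurableSpace H] [BorelSpace H]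
        (P : Measure (H × ℝ)) [IsProbabilityMeasure P]
        (d : ℕ∞) (v : HilbertBasis {j : ℕ // (j : ℕ∞) < d} ℝ H) (lam : ℕ → ℝ) (τ σ : ℝ)
        (Ω : Type*) [MeasurableSpace Ω] (μ : Measure Ω) [IsProbabilityMeasure μ]
        (n M : ℕ) (e : Fin M × Fin (n / M) ≃ Fin n)
        (x : Fin n → Ω → H) (ε : Fin n → Ω → ℝ) (βstar : H),
        0 < τ → 0 < σ → 1 ≤ M → M ≤ n →
        -- the population: design, noise, and lower bound on the noise variance
        DesignAssumption P d v lam σx τ → NoiseLowerBound P σ →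
        -- the sample is i.i.d. from the population
        (∀ i, Measurable (x i)) → (∀ i, Measurable (ε i)) →
        (∀ i, μ.map (fun ω => (x i ω, ε i ω)) = P) →
        iIndepFun (fun i ω => (x i ω, ε i ω)) μ →
        GeneralPosition μ v e x →
        -- the effective dimension is finite and at most `n / (c M)`
        ∀ k : ℕ, effDim lam a ((n : ℝ) / M) = k → (k : ℝ) ≤ n / (c * M) →
          1 - 10 * M * Real.exp (-(1 / c) * ((n : ℝ) / M)) ≤
            μ.real {ω | ENNReal.ofReal
                (ca * σ ^ 2 * ((k : ℝ) / n + (n : ℝ) / M ^ 2 * (1 / effRankSq lam k)))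
              ≤ condExcessRisk μ v lam e x ε βstar ω} := by
  refine ⟨rateConst σx, one_lt_rateConst σx, fun a ha => ⟨riskConst σx a / 2,
    half_pos (riskConst_pos hσx ha), ?_⟩⟩
  intro H _ _ _ _ _ _ P _ d v lam τ σ Ω _ μ _ n M e x ε βstar _ hσ hM hMn hD hV hx hε hlaw hind
    hGP k hk hkc
  have hN : 0 < n / M := Nat.div_pos hMn hM
  -- The division `n / M` in `ℕ` is exact because `e` is a bijection.
  have hn : n = M * (n / M) := by simpa using (Fintype.card_congr e).symm
  have hM' : (0 : ℝ) < M := by exact_mod_cast hM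
  have hnM : (n : ℝ) / M = ((n / M : ℕ) : ℝ) := by
    rw [div_eq_iff hM'.ne', mul_comm]
    exact_mod_cast hn
  rw [mul_comm, ← div_div, hnM] at hkc
  rw [hnM] at hk
  have key := measureReal_condExcessRisk_ge hD hσx hσ hV hM hN e βstar hx hε hlaw hind hGP ha hk hkc
  rwa [← hnM] at key
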